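/- **Definitions.** Let $G=(V,E)$ be a finite graph and $k\ge 1$ an integer. A *$k$-block* is a maximal set $X\subseteq V$ of at least $k$ vertices such that no two vertices of $X$ can be separated in $G$ by fewer than $k$ other vertices. A *separation* is an ordered pair $(A,B)$ with $A\cup B=V$ and no edge between $A\setminus B$ and $B\setminus A$; its *inverse* is $(B,A)$, it is *proper* if $A\not\subseteq B$ and $B\not\subseteq A$, its *order* is $|A\cap B|$, it is a *$(<k)$-separation* if its order is less than $k$, and it is *tight* if every vertex of $A\cap B$ has a neighbour in $A\setminus B$ and a neighbour in $B\setminus A$. Write $(A,B)\le(C,D)$ if $A\subseteq C$ and $D\subseteq B$. Two separations are *nested* if one of them is $\le$-comparable with the other or its inverse; otherwise they *cross*. For a $k$-block $X$, let $P_k(X)$ be the set of proper $(<k)$-separations $(A,B)$ with $X\subseteq B$, and let $\mathcal P$ be the set of all these $P_k(X)$ (the $k$-block profiles). A separation $(A,B)$ *distinguishes* $P,Q\in\mathcal P$ if one of $P,Q$ contains $(A,B)$ and the other contains $(B,A)$. Let $S$ be a set of proper $(<k)$-separations of $G$ that is closed under taking inverses. A $k$-block $X$ is *well separated in $S$* if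 the maximal elements of $P_k(X)\cap S$ are pairwise nested. The task $(S,\mathcal P)$ is *reduced* if every element of $S$ distinguishes some two elements of $\mathcal P$. It is *feasible* if any two distinct elements of $\mathcal P$ are distinguished by an element of $S$ and, whenever $(A,B),(C,D)\in S$ cross and there are $P,Q\in\mathcal P$ with $(A,B),(C,D)\in P$ and $(B,A),(D,C)\in Q$, there is some $(E,F)\in S$ with $(A\cup C,B\cap D)\le(E,F)$. For a tree-decomposition $(T,(V_t)_{t\in T})$ of $G$ with $T$ a finite tree, each oriented edge $e=st$ of $T$ *induces* the pair $\bigl(\bigcup_{u\in T_s}V_u,\bigcup_{u\in T_t}V_u\bigr)$, where $T_s,T_t$ are the components of $T-e$ containing $s$ and $t$. The decomposition is *canonical* (relative to $S$) if for every automorphism $\varphi$ of $G$ that maps $S$ onto itself there is an automorphism $\pi$ of $T$ with $V_{\pi(t)}=\varphi(V_t)$ for all $t\in T$. A *leaf part* is a part $V_t$ with $t$ of degree $1$ in $T$. A tree-decomposition $(T',\mathcal V')$ *refines* $(T,\mathcal V)$ if the latter arises from the former by contracting disjoint connected subgraphs of $T'$ and merging (taking the union of) the corresponding parts. **Theorem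 3.1.** Let $k\ge1$, let $G$ be a finite graph, and let $S$ be a set of proper $(<k)$-separations of $G$ that is closed under taking inverses and contains all the tight proper $(<k)$-separations. Then $G$ has a canonical tree-decomposition, with all the separations induced by its tree-edges in $S$, such that (i) distinct $k$-blocks lie in different parts (every $k$-block is contained in some part, and parts containing distinct $k$-blocks are distinct); (ii) every part containing a $k$-block that is well separated in $S$ equals that $k$-block; (iii) if the task $(S,\mathcal P)$ is reduced and feasible, then every leaf part is a $k$-block. Moreover, every canonical tree-decomposition of $G$ that satisfies (i), and all of whose separations induced by tree-edges are in $S$, can be refined to a canonical tree-decomposition, again with all the separations induced by its tree-edges in $S$, that satisfies (i), (ii) and (iii). -/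

import Mathlib

/-- A separation of a graph `G`: an ordered pair `(left, right)` of vertex sets whose union is the
whole vertex set, with no edge between `left \ right` and `right \ left`. -/
@[ext]
structure GraphSep {V : Type*} (G : SimpleGraph V) where
  left : Set V
  right : Set V
  union_eq : left ∪ right = Set.univ
  not_adj : ∀ a ∈ left \ right, ∀ b ∈ right \ left, ¬ G.Adj a b

namespace GraphSep

variable {V : Type*} {G : SimpleGraph V}

/-- `(A, B) ≤ (C, D)` if and only if `A ⊆ C` and `D ⊆ B`. -/
instance : PartialOrder (GraphSep G) where
  le A C := A.left ⊆ C.left ∧ C.right ⊆ A.right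
  le_refl _ := ⟨subset_rfl, subset_rfl⟩
  le_trans _ _ _ h h' := ⟨h.1.trans h'.1, h'.2.trans h.2⟩
  le_antisymm _ _ h h' := GraphSep.ext (h.1.antisymm h'.1) (h'.2.antisymm h.2)

/-- The inverse `(B, A)` of the separation `(A, B)`. -/
def inv (A : GraphSep G) : GraphSep G where
  left := A.right
  right := A.left
  union_eq := by rw [Set.union_comm]; exact A.union_eq
  not_adj a ha b hb h := A.not_adj b hb a ha h.symm

/-- The corner separation `(A ∪ C, B ∩ D)` of the separations `(A, B)` and `(C, D)`. -/
def corner (A C : GraphSep G) : GraphSep G where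
  left := A.left ∪ C.left
  right := A.right ∩ C.right
  union_eq := by
    ext v
    have h1 : v ∈ A.left ∪ A.right := A.union_eq ▸ Set.mem_univ v
    have h2 : v ∈ C.left ∪ C.right := C.union_eq ▸ Set.mem_univ v
    simp only [Set.mem_union, Set.mem_inter_iff, Set.mem_univ, iff_true] at *
    tauto
  not_adj a ha b hb h := by
    have h1 : a ∈ A.left ∪ A.right := A.union_eq ▸ Set.mem_univ a
    have h2 : a ∈ C.left ∪ C.right := C.union_eq ▸ Set.mem_univ a
    have h3 := A.not_adj a
    have h4 := C.not_adj a
    simp only [Set.mem_union, Set.mem_inter_iff, Set.mem_sdiff] at *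
    by_cases h5 : a ∈ A.right
    · exact h4 ⟨by tauto, by tauto⟩ b ⟨hb.1.2, by tauto⟩ h
    · exact h3 ⟨by tauto, h5⟩ b ⟨hb.1.1, by tauto⟩ h

/-- The image `(φ(A), φ(B))` of the separation `(A, B)` under an automorphism `φ` of `G`. -/
def map (φ : G ≃g G) (A : GraphSep G) : GraphSep G where
  left := φ '' A.left
  right := φ '' A.right
  union_eq := by
    rw [← Set.image_union, A.union_eq]
    exact Set.image_univ_of_surjective φ.surjective
  not_adj := by
    rintro _ ⟨⟨a, ha, rfl⟩, ha'⟩ _ ⟨⟨b, hb, rfl⟩, hb'⟩ h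
    exact A.not_adj a ⟨ha, fun h' => ha' ⟨a, h', rfl⟩⟩ b ⟨hb, fun h' => hb' ⟨b, h', rfl⟩⟩
      (φ.map_adj_iff.1 h)

/-- The order `|A ∩ B|` of a separation `(A, B)` (of a finite graph). -/
noncomputable def order (A : GraphSep G) : ℕ := (A.left ∩ A.right).ncard

/-- A separation is proper if neither side contains the other. -/
def IsProper (A : GraphSep G) : Prop := ¬ A.left ⊆ A.right ∧ ¬ A.right ⊆ A.left

/-- A separation `(A, B)` is tight if every vertex of `A ∩ B` has a neighbour in `A \ B` and
a neighbour in `B \ A`. -/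
def IsTight (A : GraphSep G) : Prop :=
  ∀ v ∈ A.left ∩ A.right,
    (∃ a ∈ A.left \ A.right, G.Adj v a) ∧ (∃ b ∈ A.right \ A.left, G.Adj v b)

/-- Two separations are nested if the first is comparable with the second or with the inverse
of the second. Separations that are not nested cross. -/
def Nested (A C : GraphSep G) : Prop := A ≤ C ∨ C ≤ A ∨ A ≤ C.inv ∨ C.inv ≤ A

end GraphSep

section Blocks

variable {V : Type*} (G : SimpleGraph V) (k : ℕ)

/-- The vertices `x` and `y` can be separated in `G` by fewer than `k` vertices other than
`x` and `y`. -/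
def SeparableByFewer (x y : V) : Prop :=
  ∃ Z : Set V, Z.Finite ∧ Z.ncard < k ∧ x ∉ Z ∧ y ∉ Z ∧ ∀ p : G.Walk x y, ∃ z ∈ p.support, z ∈ Z

/-- A `k`-block: a maximal set of at least `k` vertices no two of which can be separated by fewer
than `k` other vertices. -/
def IsKBlock (X : Set V) : Prop :=
  Maximal (fun Y : Set V => k ≤ Y.ncard ∧ ∀ x ∈ Y, ∀ y ∈ Y, x ≠ y → ¬ SeparableByFewer G k x y) X

/-- The `k`-profile `P_k(X)` induced by `X`: all proper `(< k)`-separations `(A, B)` with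
`X ⊆ B`. -/
def blockProfile (X : Set V) : Set (GraphSep G) :=
  {A | A.IsProper ∧ A.order < k ∧ X ⊆ A.right}

/-- The set of all `k`-block profiles of `G`. -/
def blockProfiles : Set (Set (GraphSep G)) :=
  {P | ∃ X : Set V, IsKBlock G k X ∧ P = blockProfile G k X}

end Blocks

section Tasks

variable {V : Type*} {G : SimpleGraph V}

/-- A set `P` of separations is well separated in `S` if the maximal elements of `P ∩ S` are
nested with each other. -/
def WellSeparatedIn (S P : Set (GraphSep G)) : Prop :=
  ∀ A C : GraphSep G, Maximal (· ∈ P ∩ S) A → Maximal (· ∈ P ∩ S) C → A.Nested C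

/-- The separation `A` distinguishes the profiles `P` and `Q`: they orient it differently. -/
def Distinguishes (A : GraphSep G) (P Q : Set (GraphSep G)) : Prop :=
  (A ∈ P ∧ A.inv ∈ Q) ∨ (A.inv ∈ P ∧ A ∈ Q)

/-- The task `(S, Pr)` is reduced: every separation in `S` distinguishes some two profiles
in `Pr`. -/
def IsReducedTask (S : Set (GraphSep G)) (Pr : Set (Set (GraphSep G))) : Prop :=
  ∀ A ∈ S, ∃ P ∈ Pr, ∃ Q ∈ Pr, Distinguishes A P Q

/-- The task `(S, Pr)` is feasible: `S` distinguishes all the profiles in `Pr`, and whenever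
`(A, B)` and `(C, D)` in `S` cross and there are `P, Q ∈ Pr` with `(A, B), (C, D) ∈ P` and
`(B, A), (D, C) ∈ Q`, there is some `(E, F) ∈ S` with `(A ∪ C, B ∩ D) ≤ (E, F)`
(for instance that corner separation itself). -/
def IsFeasibleTask (S : Set (GraphSep G)) (Pr : Set (Set (GraphSep G))) : Prop :=
  (∀ P ∈ Pr, ∀ Q ∈ Pr, P ≠ Q → ∃ A ∈ S, Distinguishes A P Q) ∧
  ∀ A ∈ S, ∀ C ∈ S, ¬ A.Nested C → ∀ P ∈ Pr, ∀ Q ∈ Pr,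
    A ∈ P → C ∈ P → A.inv ∈ Q → C.inv ∈ Q → ∃ E ∈ S, A.corner C ≤ E

end Tasks

/-- A tree-decomposition of `G` whose decomposition tree has the node set `T`. -/
structure TreeDecomp {V : Type*} (G : SimpleGraph V) (T : Type*) where
  tree : SimpleGraph T
  isTree : tree.IsTree
  part : T → Set V
  vertex_mem : ∀ v : V, ∃ t, v ∈ part t
  edge_mem : ∀ u v : V, G.Adj u v → ∃ t, u ∈ part t ∧ v ∈ part t
  inter_subset : ∀ (r t : T) (p : tree.Walk r t), p.IsPath →
    ∀ s ∈ p.support, part r ∩ part t ⊆ part s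

namespace TreeDecomp

variable {V : Type*} {G : SimpleGraph V} {T : Type*}

/-- For a tree-edge `e = st`: the union of the parts `V_u` over all nodes `u` in the component of
`tree - e` that contains `s`. -/
def side (D : TreeDecomp G T) (s t : T) : Set V :=
  {v | ∃ u, (D.tree.deleteEdges {s(s, t)}).Reachable s u ∧ v ∈ D.part u}

/-- All the separations induced by (the two orientations of) tree-edges are in `S`. -/
def EdgesIn (D : TreeDecomp G T) (S : Set (GraphSep G)) : Prop :=
  ∀ s t : T, D.tree.Adj s t → ∃ A ∈ S, A.left = D.side s t ∧ A.right = D.side t s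

/-- The decomposition is canonical relative to `S`: it is invariant under all those automorphisms
of `G` that act on `S`, in that these induce automorphisms of the decomposition tree. -/
def IsCanonical (D : TreeDecomp G T) (S : Set (GraphSep G)) : Prop :=
  ∀ φ : G ≃g G, GraphSep.map φ '' S = S →
    ∃ π : D.tree ≃g D.tree, ∀ t, D.part (π t) = φ '' D.part t

/-- Distinct `k`-blocks lie in different parts. -/
def SeparatesBlocks (D : TreeDecomp G T) (k : ℕ) : Prop :=
  (∀ X, IsKBlock G k X → ∃ t, X ⊆ D.part t) ∧
  ∀ X Y, IsKBlock G k X → IsKBlock G k Y → X ≠ Y →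
    ∀ s t, X ⊆ D.part s → Y ⊆ D.part t → D.part s ≠ D.part t

/-- Parts containing a `k`-block that is well separated in `S` coincide with that `k`-block. -/
def WellSeparatedBlocksAreParts (D : TreeDecomp G T) (k : ℕ) (S : Set (GraphSep G)) : Prop :=
  ∀ X, IsKBlock G k X → WellSeparatedIn S (blockProfile G k X) →
    ∀ t, X ⊆ D.part t → D.part t = X

/-- Every leaf part is a `k`-block. -/
def LeavesAreBlocks (D : TreeDecomp G T) (k : ℕ) : Prop :=
  ∀ t, (D.tree.neighborSet t).ncard = 1 → IsKBlock G k (D.part t)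

/-- `D'` refines `D`: the decomposition `D` is obtained from `D'` by contracting connected
subgraphs (the fibres of `f`) of the tree and merging the corresponding parts. -/
def Refines {T' : Type*} (D' : TreeDecomp G T') (D : TreeDecomp G T) : Prop :=
  ∃ f : T' → T,
    (∀ t, (D'.tree.induce (f ⁻¹' {t})).Connected) ∧
    (∀ s t, D.tree.Adj s t ↔ s ≠ t ∧ ∃ s' t', f s' = s ∧ f t' = t ∧ D'.tree.Adj s' t') ∧
    ∀ t, D.part t = ⋃ t' ∈ f ⁻¹' {t}, D'.part t'

end TreeDecomp

/-! Three constructions carry the proof. Nested set. For each pair of k-blocks consider the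
separations of least order between them (`GraphSep.IsEfficient`). Orders are treated increasingly:
among the efficient separations of order l nested with everything chosen so far, those crossing
fewest separations of G are added (`nestedSeps`). Submodularity of the order keeps suitable opposite
corners efficient (`IsEfficient.corner`), and these corners together cross strictly less than the
original two (`crossNumber_corner_add_lt`). Hence the chosen separations are nested and every pair
is served. No arbitrary choice is made, so the set is invariant under automorphisms. Its elements
are tight, so they lie in S. Tree. The nodes are the consistent orientations of the nested set N,
two being adjacent if they differ on a single separation. The part of an orientation is the
intersection of the right sides of its elements, and the tree-edges induce elements of N
(`orientationTreeDecomp`). Refinement. In a decomposition satisfying (i), a part contains at most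
one k-block X. If X is well separated, the maximal elements of P_k(X) ∩ S form a star. Replacing the
node by this star leaves X as the central part: any vertex outside X is cut off from it by a tight
separation, which lies below a maximal one. This gives (ii) canonically and proves the second
assertion; the first is this refinement applied to the tree of `nestedSeps`. Finally (iii) follows
from (i) and (ii): in a reduced feasible task, every leaf part contains a block, and that block is
well separated (`leavesAreBlocks`). -/

namespace GraphSep

variable {V : Type*} {G : SimpleGraph V}

/-! ### Nestedness, corners, crossing numbers and tightness -/

lemma mem_left_or_mem_right (A : GraphSep G) (v : V) : v ∈ A.left ∨ v ∈ A.right := by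
  have h : v ∈ A.left ∪ A.right := A.union_eq ▸ Set.mem_univ v
  exact h

@[simp] lemma inv_left (A : GraphSep G) : A.inv.left = A.right := rfl

@[simp] lemma inv_right (A : GraphSep G) : A.inv.right = A.left := rfl

@[simp] lemma inv_inv (A : GraphSep G) : A.inv.inv = A := rfl

@[simp] lemma corner_left (A C : GraphSep G) : (A.corner C).left = A.left ∪ C.left := rfl

@[simp] lemma corner_right (A C : GraphSep G) : (A.corner C).right = A.right ∩ C.right := rfl

@[simp] lemma map_left (φ : G ≃g G) (A : GraphSep G) : (A.map φ).left = φ '' A.left := rfl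

@[simp] lemma map_right (φ : G ≃g G) (A : GraphSep G) : (A.map φ).right = φ '' A.right := rfl

@[simp] lemma order_inv (A : GraphSep G) : A.inv.order = A.order := by
  simp [order, Set.inter_comm]

lemma IsProper.inv {A : GraphSep G} (h : A.IsProper) : A.inv.IsProper := ⟨h.2, h.1⟩

lemma inv_le_inv {A C : GraphSep G} (h : A ≤ C) : C.inv ≤ A.inv := ⟨h.2, h.1⟩

lemma inv_le {A C : GraphSep G} (h : A.inv ≤ C) : C.inv ≤ A := ⟨h.2, h.1⟩

lemma le_inv {A C : GraphSep G} (h : A ≤ C.inv) : C ≤ A.inv := ⟨h.2, h.1⟩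

lemma IsProper.inv_ne {A : GraphSep G} (hA : A.IsProper) : A.inv ≠ A := fun h =>
  hA.1 (congrArg GraphSep.left h).ge

lemma le_corner_left (A C : GraphSep G) : A ≤ A.corner C :=
  ⟨Set.subset_union_left, Set.inter_subset_left⟩

lemma le_corner_right (A C : GraphSep G) : C ≤ A.corner C :=
  ⟨Set.subset_union_right, Set.inter_subset_right⟩

lemma corner_le {A C E : GraphSep G} (h : A ≤ E) (h' : C ≤ E) : A.corner C ≤ E :=
  ⟨Set.union_subset h.1 h'.1, Set.subset_inter h.2 h'.2⟩

lemma Nested.refl (A : GraphSep G) : A.Nested A := Or.inl le_rfl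

lemma Nested.symm {A C : GraphSep G} (h : A.Nested C) : C.Nested A := by
  rcases h with h | h | h | h
  · exact Or.inr (Or.inl h)
  · exact Or.inl h
  · exact Or.inr (Or.inr (Or.inl (le_inv h)))
  · exact Or.inr (Or.inr (Or.inr (inv_le h)))

lemma Nested.inv_right {A C : GraphSep G} (h : A.Nested C) : A.Nested C.inv := by
  rcases h with h | h | h | h
  · exact Or.inr (Or.inr (Or.inl h))
  · exact Or.inr (Or.inr (Or.inr h))
  · exact Or.inl h
  · exact Or.inr (Or.inl h)

lemma Nested.inv_left {A C : GraphSep G} (h : A.Nested C) : A.inv.Nested C :=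
  h.symm.inv_right.symm

lemma Nested.le_cases {A C : GraphSep G} (h : C.Nested A) :
    (C ≤ A ∨ C.inv ≤ A) ∨ (C ≤ A.inv ∨ C.inv ≤ A.inv) := by
  rcases h with h | h | h | h
  · exact Or.inl (Or.inl h)
  · exact Or.inr (Or.inr (inv_le_inv h))
  · exact Or.inr (Or.inl h)
  · exact Or.inl (Or.inr (inv_le h))

lemma Nested.of_le_or {A C : GraphSep G} (h : C ≤ A ∨ C.inv ≤ A) : C.Nested A := by
  rcases h with h | h
  · exact Or.inl h
  · exact Or.inr (Or.inr (Or.inr (inv_le h)))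

lemma Nested.corner_of_le {A C E : GraphSep G} (h : E ≤ A ∨ E.inv ≤ A) :
    E.Nested (A.corner C) :=
  .of_le_or (h.imp (·.trans (le_corner_left A C)) (·.trans (le_corner_left A C)))

lemma corner_comm (A C : GraphSep G) : A.corner C = C.corner A :=
  GraphSep.ext (Set.union_comm _ _) (Set.inter_comm _ _)

/-- A separation nested with two crossing separations is nested with their corners. -/
lemma Nested.corner {A C E : GraphSep G} (hAC : ¬ A.Nested C) (hA : E.Nested A)
    (hC : E.Nested C) : E.Nested (A.corner C) := by
  rcases hA.le_cases with h | h
  · exact .corner_of_le h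
  rcases hC.le_cases with h' | h'
  · rw [corner_comm]; exact .corner_of_le h'
  -- Now E or its inverse lies below A.inv, and E or its inverse lies below C.inv. Using different
  -- orientations of E would make A and C nested, so one orientation lies below both, hence below
  -- the inverse of the corner.
  have key : ∀ F : GraphSep G, F ≤ A.inv → F ≤ C.inv → F ≤ (A.corner C).inv := fun F h h' =>
    le_inv (corner_le (le_inv h) (le_inv h'))
  have cr : ∀ F : GraphSep G, F ≤ A.inv → F.inv ≤ C.inv → False := fun F h h' =>
    hAC (Or.inr (Or.inr (Or.inl ((le_inv h).trans h'))))
  rcases h with h | h <;> rcases h' with h' | h'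
  · exact Nested.inv_right (.of_le_or (Or.inl (key _ h h')))
  · exact (cr _ h h').elim
  · exact (cr _ h h').elim
  · exact Nested.inv_right (.of_le_or (Or.inr (key _ h h')))

/-- Some orientation of E lies below A or below A.inv, hence below the corner above that one. -/
lemma Nested.corner_or_corner {A E : GraphSep G} (C : GraphSep G) (hA : E.Nested A) :
    E.Nested (A.corner C) ∨ E.Nested (A.inv.corner C.inv) :=
  hA.le_cases.imp .corner_of_le .corner_of_le

lemma not_nested_inv_inv {A C : GraphSep G} (h : ¬ A.Nested C) : ¬ A.inv.Nested C.inv :=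
  fun h' => h h'.inv_left.inv_right

instance [Finite V] : Finite (GraphSep G) :=
  Finite.of_injective (fun A : GraphSep G => (A.left, A.right)) fun A C h => by
    simp only [Prod.mk.injEq] at h
    exact GraphSep.ext h.1 h.2

/-- The number of separations that cross `A`. -/
noncomputable def crossNumber (A : GraphSep G) : ℕ := {E : GraphSep G | ¬ E.Nested A}.ncard

/-- Whatever crosses a corner crosses A or C, and whatever crosses both corners crosses both A and
C. The inequality is strict because A crosses C but is nested with both corners. -/
lemma crossNumber_corner_add_lt [Finite V] {A C : GraphSep G} (h : ¬ A.Nested C) :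
    (A.corner C).crossNumber + (A.inv.corner C.inv).crossNumber <
      A.crossNumber + C.crossNumber := by
  unfold crossNumber
  rw [← Set.ncard_union_add_ncard_inter _ _ (Set.toFinite _) (Set.toFinite _),
    ← Set.ncard_union_add_ncard_inter {E : GraphSep G | ¬ E.Nested A} _ (Set.toFinite _)
      (Set.toFinite _)]
  refine add_lt_add_of_lt_of_le (Set.ncard_lt_ncard ?_ (Set.toFinite _))
    (Set.ncard_le_ncard ?_ (Set.toFinite _))
  · refine ⟨?_, fun hs => ?_⟩
    · rintro E (hE | hE) <;> by_contra hn <;>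
        simp only [Set.mem_union, Set.mem_ofPred_eq, not_or, not_not] at hn hE
      · exact hE (.corner h hn.1 hn.2)
      · exact hE (.corner (not_nested_inv_inv h) hn.1.inv_right hn.2.inv_right)
    · rcases hs (Or.inr fun h' => h h' : A ∈ _) with h' | h'
      · exact h' (.corner_of_le (Or.inl le_rfl))
      · exact h' (.corner_of_le (Or.inr le_rfl))
  · rintro E ⟨h1, h2⟩
    refine ⟨fun hE => ?_, fun hE => ?_⟩
    · exact (hE.corner_or_corner C).elim h1 h2
    · rw [Set.mem_ofPred_eq, corner_comm] at h1 h2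
      exact (hE.corner_or_corner A).elim h1 h2

/-- Submodularity: the two corner separators have their union inside the union of the separators of
A and C, and their intersection inside the intersection. -/
lemma order_corner_add_le [Finite V] (A C : GraphSep G) :
    (A.corner C).order + (A.inv.corner C.inv).order ≤ A.order + C.order := by
  unfold order
  rw [← Set.ncard_union_add_ncard_inter _ _ (Set.toFinite _) (Set.toFinite _),
    ← Set.ncard_union_add_ncard_inter (A.left ∩ A.right) _ (Set.toFinite _) (Set.toFinite _)]
  refine add_le_add (Set.ncard_le_ncard ?_ (Set.toFinite _))
    (Set.ncard_le_ncard ?_ (Set.toFinite _)) <;> intro v <;>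
  simp only [corner_left, corner_right, inv_left, inv_right, Set.mem_union, Set.mem_inter_iff] <;>
  tauto

/-- Removing from the left side a vertex of the separator that has no neighbour strictly on
the left. -/
def eraseLeft (A : GraphSep G) (w : V) (hw : w ∈ A.right)
    (h : ∀ a ∈ A.left \ A.right, ¬ G.Adj w a) : GraphSep G where
  left := A.left \ {w}
  right := A.right
  union_eq := by
    ext v
    have := A.mem_left_or_mem_right v
    by_cases hv : v = w
    · simp [hv, hw]
    · simpa [hv] using this
  not_adj a ha b hb hab := by
    by_cases hbw : b = w
    · exact h a ⟨ha.1.1, ha.2⟩ (hbw ▸ hab.symm)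
    · exact A.not_adj a ⟨ha.1.1, ha.2⟩ b ⟨hb.1, fun h' => hb.2 ⟨h', hbw⟩⟩ hab

lemma order_eraseLeft_lt [Finite V] (A : GraphSep G) (w : V) (hw : w ∈ A.right)
    (h : ∀ a ∈ A.left \ A.right, ¬ G.Adj w a) (hw' : w ∈ A.left) :
    (A.eraseLeft w hw h).order < A.order :=
  Set.ncard_lt_ncard ⟨fun _ hv => ⟨hv.1.1, hv.2⟩, fun hs => (hs ⟨hw', hw⟩).1.2 rfl⟩
    (Set.toFinite _)

/-- A separation is tight if no smaller separation arises from it by deleting a vertex from one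
of its sides. -/
lemma isTight_of_forall_order_le [Finite V] {A : GraphSep G}
    (hl : ∀ E : GraphSep G, (∃ w ∈ A.right, E.left = A.left \ {w}) → E.right = A.right →
      A.order ≤ E.order)
    (hr : ∀ E : GraphSep G, E.left = A.left → (∃ w ∈ A.left, E.right = A.right \ {w}) →
      A.order ≤ E.order) : A.IsTight := by
  intro w hw
  constructor
  · by_contra! hn
    exact (A.order_eraseLeft_lt w hw.2 hn hw.1).not_ge (hl _ ⟨w, hw.2, rfl⟩ rfl)
  · by_contra! hn
    have h1 := A.inv.order_eraseLeft_lt w hw.1 hn hw.2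
    have h2 := hr (A.inv.eraseLeft w hw.1 hn).inv rfl ⟨w, hw.1, rfl⟩
    rw [order_inv] at h1 h2
    exact h1.not_ge h2

lemma map_symm_map (φ : G ≃g G) (A : GraphSep G) : (A.map φ).map φ.symm = A := by
  ext v <;> simp [Set.mem_image]

lemma map_map_symm (φ : G ≃g G) (A : GraphSep G) : (A.map φ.symm).map φ = A := by
  ext v <;> simp [Set.mem_image]

lemma map_injective (φ : G ≃g G) : Function.Injective (map φ : GraphSep G → GraphSep G) :=
  Function.LeftInverse.injective (map_symm_map φ)

lemma map_inv (φ : G ≃g G) (A : GraphSep G) : A.inv.map φ = (A.map φ).inv := rfl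

lemma map_le_map (φ : G ≃g G) {A C : GraphSep G} (h : A ≤ C) : A.map φ ≤ C.map φ :=
  ⟨Set.image_mono h.1, Set.image_mono h.2⟩

lemma map_le_map_iff (φ : G ≃g G) {A C : GraphSep G} : A.map φ ≤ C.map φ ↔ A ≤ C :=
  ⟨fun h => by simpa only [map_symm_map] using map_le_map φ.symm h, map_le_map φ⟩

lemma map_nested_iff (φ : G ≃g G) {A C : GraphSep G} :
    (A.map φ).Nested (C.map φ) ↔ A.Nested C := by
  simp only [Nested, ← map_inv, map_le_map_iff]

lemma order_map (φ : G ≃g G) (A : GraphSep G) : (A.map φ).order = A.order := by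
  unfold order
  rw [map_left, map_right, ← Set.image_inter φ.injective, Set.ncard_image_of_injective _ φ.injective]

lemma IsProper.map (φ : G ≃g G) {A : GraphSep G} (h : A.IsProper) : (A.map φ).IsProper :=
  ⟨fun h' => h.1 ((Set.image_subset_image_iff φ.injective).1 h'),
    fun h' => h.2 ((Set.image_subset_image_iff φ.injective).1 h')⟩

lemma crossNumber_map (φ : G ≃g G) (A : GraphSep G) :
    (A.map φ).crossNumber = A.crossNumber := by
  unfold crossNumber
  have : {E : GraphSep G | ¬ E.Nested (A.map φ)} = map φ '' {E | ¬ E.Nested A} := by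
    ext E
    constructor
    · intro h
      refine ⟨E.map φ.symm, fun h' => h ?_, map_map_symm φ E⟩
      rw [← map_nested_iff φ, map_map_symm] at h'
      exact h'
    · rintro ⟨E, h, rfl⟩ h'
      exact h ((map_nested_iff φ).1 h')
  rw [this, Set.ncard_image_of_injective _ (map_injective φ)]

end GraphSep

/-! ### k-blocks and the separations of order less than k -/

section Blocks

variable {V : Type*} {G : SimpleGraph V} {k : ℕ}

lemma SeparableByFewer.symm {x y : V} (h : SeparableByFewer G k x y) :
    SeparableByFewer G k y x := by
  obtain ⟨Z, hf, hZ, hx, hy, h⟩ := h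
  refine ⟨Z, hf, hZ, hy, hx, fun p => ?_⟩
  obtain ⟨z, hz, hz'⟩ := h p.reverse
  exact ⟨z, by simpa using hz, hz'⟩

lemma SeparableByFewer.map {x y : V} (φ : G ≃g G) (h : SeparableByFewer G k x y) :
    SeparableByFewer G k (φ x) (φ y) := by
  obtain ⟨Z, hf, hZ, hx, hy, h⟩ := h
  refine ⟨φ '' Z, hf.image _, by rwa [Set.ncard_image_of_injective _ φ.injective], ?_, ?_, ?_⟩
  · simpa using hx
  · simpa using hy
  · intro p
    obtain ⟨z, hz, hz'⟩ := h ((p.map φ.symm.toHom).copy (φ.symm_apply_apply x)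
      (φ.symm_apply_apply y))
    simp only [SimpleGraph.Walk.support_copy, SimpleGraph.Walk.support_map, List.mem_map] at hz
    obtain ⟨w, hw, rfl⟩ := hz
    exact ⟨w, hw, _, hz', φ.apply_symm_apply w⟩

lemma IsKBlock.image {X : Set V} (hX : IsKBlock G k X) (φ : G ≃g G) :
    IsKBlock G k (φ '' X) := by
  have key : ∀ (ψ : G ≃g G) (Y : Set V),
      (k ≤ Y.ncard ∧ ∀ x ∈ Y, ∀ y ∈ Y, x ≠ y → ¬ SeparableByFewer G k x y) →
      (k ≤ (ψ '' Y).ncard ∧ ∀ x ∈ ψ '' Y, ∀ y ∈ ψ '' Y, x ≠ y → ¬ SeparableByFewer G k x y) := by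
    rintro ψ Y ⟨h1, h2⟩
    refine ⟨by rwa [Set.ncard_image_of_injective _ ψ.injective], ?_⟩
    rintro _ ⟨x, hx, rfl⟩ _ ⟨y, hy, rfl⟩ hxy h
    exact h2 x hx y hy (fun h' => hxy (congrArg ψ h')) (by simpa using h.map ψ.symm)
  refine ⟨key φ X hX.prop, fun Y hY hle => ?_⟩
  have h1 : X ⊆ φ.symm '' Y := fun x hx => ⟨φ x, hle ⟨x, hx, rfl⟩, φ.symm_apply_apply x⟩
  intro y hy
  exact ⟨φ.symm y, hX.le_of_ge (key φ.symm Y hY) h1 ⟨y, hy, rfl⟩, φ.apply_symm_apply y⟩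

lemma GraphSep.exists_mem_support_inter (A : GraphSep G) {x y : V} (p : G.Walk x y)
    (hx : x ∈ A.left) (hy : y ∈ A.right) : ∃ z ∈ p.support, z ∈ A.left ∩ A.right := by
  induction p with
  | nil => exact ⟨_, by simp, hx, hy⟩
  | @cons u v w h p ih =>
    by_cases hu : u ∈ A.right
    · exact ⟨u, by simp, hx, hu⟩
    · have hv : v ∈ A.left := by
        by_contra hv
        exact A.not_adj u ⟨hx, hu⟩ v ⟨(A.mem_left_or_mem_right v).resolve_left hv, hv⟩ h
      obtain ⟨z, hz, hz'⟩ := ih hv hy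
      exact ⟨z, by simp [hz], hz'⟩

lemma exists_separation_of_separable {x y : V} (h : SeparableByFewer G k x y) :
    ∃ A : GraphSep G, A.order < k ∧ x ∈ A.left \ A.right ∧ y ∈ A.right \ A.left := by
  obtain ⟨Z, -, hZ, hx, hy, h⟩ := h
  let K : Set V := {w | ∃ p : G.Walk x w, ∀ z ∈ p.support, z ∉ Z}
  have hKZ : ∀ w ∈ K, w ∉ Z := fun w ⟨p, hp⟩ => hp w p.end_mem_support
  have hyK : y ∉ K := by
    rintro ⟨p, hp⟩
    obtain ⟨z, hz, hz'⟩ := h p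
    exact hp z hz hz'
  have hxK : x ∈ K := ⟨.nil, by simpa using hx⟩
  -- K is the component of x in G - Z, and the separator of A is exactly Z.
  let A : GraphSep G :=
    { left := K ∪ Z
      right := Kᶜ
      union_eq := by ext v; by_cases v ∈ K <;> simp [*]
      not_adj := by
        rintro a ⟨-, ha⟩ b ⟨hb, hb'⟩ hab
        obtain ⟨p, hp⟩ := not_not.1 ha
        refine hb ⟨p.concat hab, fun z hz => ?_⟩
        rw [SimpleGraph.Walk.support_concat, List.mem_append,
          List.mem_singleton] at hz
        rcases hz with hz | rfl
        · exact hp z hz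
        · exact fun h => hb' (Or.inr h) }
  refine ⟨A, ?_, ⟨Or.inl hxK, not_not.2 hxK⟩, hyK, fun h' => h'.elim hyK hy⟩
  have : A.left ∩ A.right = Z := by
    ext v
    refine ⟨fun ⟨h1, h2⟩ => h1.resolve_left h2, fun hv => ⟨Or.inr hv, fun h' => hKZ v h' hv⟩⟩
  rwa [GraphSep.order, this]

variable [Finite V]

/-- Two vertices of X strictly on different sides would be separated by the separator of A. -/
lemma IsKBlock.subset_left_or_right {X : Set V} (hX : IsKBlock G k X) {A : GraphSep G}
    (hA : A.order < k) : X ⊆ A.left ∨ X ⊆ A.right := by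
  by_contra! h
  obtain ⟨⟨x, hx, hxl⟩, y, hy, hyr⟩ := And.intro (Set.not_subset.1 h.1) (Set.not_subset.1 h.2)
  have hxr := (A.mem_left_or_mem_right x).resolve_left hxl
  have hyl := (A.mem_left_or_mem_right y).resolve_right hyr
  refine hX.prop.2 y hy x hx (fun h => hyr (h ▸ hxr))
    ⟨A.left ∩ A.right, Set.toFinite _, hA, fun h => hyr h.2, fun h => hxl h.1, fun p => ?_⟩
  exact A.exists_mem_support_inter p hyl hxr

lemma IsKBlock.not_subset_right {X : Set V} (hX : IsKBlock G k X) {A : GraphSep G}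
    (hA : A.order < k) (hl : X ⊆ A.left) : ¬ X ⊆ A.right := fun hr =>
  absurd (hX.prop.1.trans (Set.ncard_le_ncard (Set.subset_inter hl hr) (Set.toFinite _)))
    (not_le.2 hA)

lemma IsKBlock.isProper {X Y : Set V} (hX : IsKBlock G k X) (hY : IsKBlock G k Y)
    {A : GraphSep G} (hA : A.order < k) (h : X ⊆ A.left) (h' : Y ⊆ A.right) : A.IsProper :=
  ⟨fun hs => hX.not_subset_right hA h (h.trans hs),
    fun hs => hY.not_subset_right hA (h'.trans hs) h'⟩

/-- A set of separations has an element of minimum order. -/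
lemma exists_minimum_order {Q : Set (GraphSep G)} (hQ : Q.Nonempty) :
    ∃ A ∈ Q, ∀ E ∈ Q, A.order ≤ E.order :=
  Q.toFinite.exists_minimalFor GraphSep.order Q hQ |>.imp fun A hA =>
    ⟨hA.1, fun E hE => (le_total A.order E.order).elim id fun h => hA.2 hE h⟩

/-- A `k`-block is the intersection of the sides containing it of the tight `(< k)`-separations. -/
lemma IsKBlock.exists_tight_not_mem {X : Set V} (hX : IsKBlock G k X) {v : V} (hv : v ∉ X) :
    ∃ A : GraphSep G, A.IsTight ∧ A ∈ blockProfile G k X ∧ v ∉ A.right := by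
  obtain ⟨x, hx, hvx⟩ : ∃ x ∈ X, SeparableByFewer G k v x := by
    by_contra! hn
    refine hv (hX.le_of_ge (y := insert v X) ⟨?_, ?_⟩ (Set.subset_insert v X)
      (Set.mem_insert v X))
    · exact hX.prop.1.trans (Set.ncard_le_ncard (Set.subset_insert v X) (Set.toFinite _))
    · rintro a (rfl | ha) b (rfl | hb) hab
      · exact (hab rfl).elim
      · exact hn b hb
      · exact fun h => hn a ha h.symm
      · exact hX.prop.2 a ha b hb hab
  obtain ⟨A₀, hA₀, h₀⟩ := exists_separation_of_separable hvx
  -- Least order is taken among separations with v and x strictly on opposite sides. Erasing a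
  -- separator vertex from one side preserves this, so minimality yields tightness.
  obtain ⟨A, hA, hmin⟩ := exists_minimum_order
    (Q := {A : GraphSep G | v ∈ A.left \ A.right ∧ x ∈ A.right \ A.left}) ⟨A₀, h₀⟩
  have hk : A.order < k := (hmin A₀ h₀).trans_lt hA₀
  refine ⟨A, GraphSep.isTight_of_forall_order_le ?_ ?_, ⟨⟨fun h => hA.1.2 (h hA.1.1),
    fun h => hA.2.2 (h hA.2.1)⟩, hk, (hX.subset_left_or_right hk).resolve_left
      fun h => hA.2.2 (h hx)⟩, hA.1.2⟩
  · rintro E ⟨w, hw, h1⟩ h2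
    refine hmin E ⟨⟨?_, h2 ▸ hA.1.2⟩, h2 ▸ hA.2.1, h1 ▸ fun h => hA.2.2 h.1⟩
    rw [h1]
    exact ⟨hA.1.1, fun h => hA.1.2 (by rw [h]; exact hw)⟩
  · rintro E h1 ⟨w, hw, h2⟩
    refine hmin E ⟨⟨h1 ▸ hA.1.1, h2 ▸ fun h => hA.1.2 h.1⟩, ?_, h1 ▸ hA.2.2⟩
    rw [h2]
    exact ⟨hA.2.1, fun h => hA.2.2 (by rw [h]; exact hw)⟩

lemma IsKBlock.exists_separation {X Y : Set V} (hX : IsKBlock G k X) (hY : IsKBlock G k Y)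
    (hXY : X ≠ Y) : ∃ A : GraphSep G, A.order < k ∧ X ⊆ A.left ∧ Y ⊆ A.right := by
  obtain ⟨v, hv, hvY⟩ := Set.not_subset.1 fun h : X ⊆ Y =>
    hXY (h.antisymm (hX.le_of_ge hY.prop h))
  obtain ⟨A, -, hA, hvA⟩ := hY.exists_tight_not_mem hvY
  exact ⟨A, hA.2.1, (hX.subset_left_or_right hA.2.1).resolve_right fun h => hvA (h hv), hA.2.2⟩

end Blocks

/-! ### A canonical nested set distinguishing all k-blocks -/

section NestedSet

variable {V : Type*} {G : SimpleGraph V} {k : ℕ}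

/-- `A` separates the `k`-blocks `X` (on its left) and `Y` (on its right), and has the least order
of all separations doing so. -/
structure GraphSep.IsEfficient (k : ℕ) (A : GraphSep G) (X Y : Set V) : Prop where
  isKBlock_left : IsKBlock G k X
  isKBlock_right : IsKBlock G k Y
  order_lt : A.order < k
  subset_left : X ⊆ A.left
  subset_right : Y ⊆ A.right
  order_le : ∀ E : GraphSep G, X ⊆ E.left → Y ⊆ E.right → A.order ≤ E.order

namespace GraphSep.IsEfficient

variable {A C : GraphSep G} {X Y X' Y' : Set V}

lemma inv (h : A.IsEfficient k X Y) : A.inv.IsEfficient k Y X where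
  isKBlock_left := h.isKBlock_right
  isKBlock_right := h.isKBlock_left
  order_lt := by simpa using h.order_lt
  subset_left := h.subset_right
  subset_right := h.subset_left
  order_le E h1 h2 := by simpa using h.order_le E.inv h2 h1

lemma of_order_le (h : A.IsEfficient k X Y) (hC : C.order ≤ A.order) (hX : X ⊆ C.left)
    (hY : Y ⊆ C.right) : C.IsEfficient k X Y where
  isKBlock_left := h.isKBlock_left
  isKBlock_right := h.isKBlock_right
  order_lt := hC.trans_lt h.order_lt
  subset_left := hX
  subset_right := hY
  order_le E h1 h2 := hC.trans (h.order_le E h1 h2)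

lemma map (h : A.IsEfficient k X Y) (φ : G ≃g G) :
    (A.map φ).IsEfficient k (φ '' X) (φ '' Y) where
  isKBlock_left := h.isKBlock_left.image φ
  isKBlock_right := h.isKBlock_right.image φ
  order_lt := by rw [order_map]; exact h.order_lt
  subset_left := Set.image_mono h.subset_left
  subset_right := Set.image_mono h.subset_right
  order_le E h1 h2 := by
    rw [order_map, ← order_map φ.symm E]
    exact h.order_le _ (fun x hx => ⟨φ x, h1 ⟨x, hx, rfl⟩, φ.symm_apply_apply x⟩)
      (fun x hx => ⟨φ x, h2 ⟨x, hx, rfl⟩, φ.symm_apply_apply x⟩)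

variable [Finite V]

lemma isProper (h : A.IsEfficient k X Y) : A.IsProper :=
  h.isKBlock_left.isProper h.isKBlock_right h.order_lt h.subset_left h.subset_right

/-- Erasing a separator vertex from one side would give a smaller separation. The block on the
shrunken side is still there, since it cannot lie in the other, unchanged side; this contradicts
least order. -/
lemma isTight (h : A.IsEfficient k X Y) : A.IsTight := by
  refine isTight_of_forall_order_le ?_ ?_
  · rintro E ⟨w, hw, h1⟩ h2
    by_contra! hlt
    have hr : Y ⊆ E.right := h2 ▸ h.subset_right
    refine absurd (h.order_le E ?_ hr) hlt.not_ge
    exact (h.isKBlock_left.subset_left_or_right (hlt.trans h.order_lt)).resolve_right fun h' =>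
      h.isKBlock_left.not_subset_right h.order_lt h.subset_left (h2 ▸ h')
  · rintro E h1 ⟨w, hw, h2⟩
    by_contra! hlt
    have hl : X ⊆ E.left := h1 ▸ h.subset_left
    refine absurd (h.order_le E hl ?_) hlt.not_ge
    exact (h.isKBlock_right.subset_left_or_right (hlt.trans h.order_lt)).resolve_left fun h' =>
      h.isKBlock_right.not_subset_right h.order_lt (h1 ▸ h') h.subset_right

/-- Two opposite corners of efficient separations are efficient if each contains one of the
blocks. -/
lemma corner (h : A.IsEfficient k X Y) (h' : C.IsEfficient k X' Y') (hY : Y ⊆ C.right)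
    (hX' : X' ⊆ A.left) :
    ((A.corner C).IsEfficient k X Y ∧ (A.corner C).order = A.order) ∧
      ((A.inv.corner C.inv).inv.IsEfficient k X' Y' ∧
        (A.inv.corner C.inv).inv.order = C.order) := by
  have hsum := order_corner_add_le A C
  have hX1 : X ⊆ (A.corner C).left := h.subset_left.trans Set.subset_union_left
  have hY1 : Y ⊆ (A.corner C).right := Set.subset_inter h.subset_right hY
  have hX2 : X' ⊆ (A.inv.corner C.inv).inv.left := Set.subset_inter hX' h'.subset_left
  have hY2 : Y' ⊆ (A.inv.corner C.inv).inv.right := h'.subset_right.trans Set.subset_union_right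
  -- Both corners still separate their pairs, so neither order falls below that of A or C
  -- respectively; submodularity then forces equality in both bounds.
  have h1 := h.order_le _ hX1 hY1
  have h2 := h'.order_le _ hX2 hY2
  rw [order_inv] at h2
  refine ⟨⟨h.of_order_le (by omega) hX1 hY1, by omega⟩,
    h'.of_order_le (by rw [order_inv]; omega) hX2 hY2, by rw [order_inv]; omega⟩

end GraphSep.IsEfficient

open GraphSep

/-- The efficient separations of `X` and `Y` that have order `l` and are nested with all of `N`. -/
def nestedCandidates (k l : ℕ) (N : Set (GraphSep G)) (X Y : Set V) : Set (GraphSep G) :=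
  {A | A.IsEfficient k X Y ∧ A.order = l ∧ ∀ E ∈ N, E.Nested A}

/-- The candidates of order `l` that have least crossing number for some pair of blocks. -/
def nestedLayer (k l : ℕ) (N : Set (GraphSep G)) : Set (GraphSep G) :=
  {A | ∃ X Y, A ∈ nestedCandidates k l N X Y ∧
    ∀ E ∈ nestedCandidates k l N X Y, A.crossNumber ≤ E.crossNumber}

/-- A canonical nested set of separations distinguishing all `k`-blocks that are separated by
fewer than `l` vertices. -/
def nestedSeps (G : SimpleGraph V) (k : ℕ) : ℕ → Set (GraphSep G)
  | 0 => ∅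
  | l + 1 => nestedSeps G k l ∪ nestedLayer k l (nestedSeps G k l)

lemma GraphSep.crossNumber_inv (A : GraphSep G) : A.inv.crossNumber = A.crossNumber := by
  unfold crossNumber
  congr 1
  ext E
  exact not_congr ⟨fun h => h.inv_right, fun h => h.inv_right⟩

section

variable {l : ℕ} {N : Set (GraphSep G)} {X Y X' Y' : Set V} {A C : GraphSep G}

lemma inv_mem_nestedCandidates (h : A ∈ nestedCandidates k l N X Y) :
    A.inv ∈ nestedCandidates k l N Y X :=
  ⟨h.1.inv, by simpa using h.2.1, fun E hE => (h.2.2 E hE).inv_right⟩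

lemma map_mem_nestedCandidates (hN : ∀ (φ : G ≃g G), ∀ A ∈ N, A.map φ ∈ N) (φ : G ≃g G)
    (h : A ∈ nestedCandidates k l N X Y) :
    A.map φ ∈ nestedCandidates k l N (φ '' X) (φ '' Y) := by
  refine ⟨h.1.map φ, by rw [order_map]; exact h.2.1, fun E hE => ?_⟩
  have := h.2.2 _ (hN φ.symm E hE)
  rwa [← map_nested_iff φ, map_map_symm] at this

lemma inv_mem_nestedLayer (h : A ∈ nestedLayer k l N) : A.inv ∈ nestedLayer k l N := by
  obtain ⟨X, Y, h, hmin⟩ := h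
  refine ⟨Y, X, inv_mem_nestedCandidates h, fun E hE => ?_⟩
  rw [crossNumber_inv, ← crossNumber_inv E]
  exact hmin _ (inv_mem_nestedCandidates hE)

lemma map_mem_nestedLayer (hN : ∀ (φ : G ≃g G), ∀ A ∈ N, A.map φ ∈ N) (φ : G ≃g G)
    (h : A ∈ nestedLayer k l N) : A.map φ ∈ nestedLayer k l N := by
  obtain ⟨X, Y, h, hmin⟩ := h
  refine ⟨_, _, map_mem_nestedCandidates hN φ h, fun E hE => ?_⟩
  have := map_mem_nestedCandidates hN φ.symm hE
  have hs : ∀ Z : Set V, φ.symm '' (φ '' Z) = Z := fun Z => by ext v; simp [Set.mem_image]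
  rw [hs, hs] at this
  rw [crossNumber_map, ← crossNumber_map φ.symm E]
  exact hmin _ this

variable [Finite V]

/-- If A and C crossed, two opposite corners would again be candidates for the same two pairs, with
smaller total crossing number than the two minima. -/
lemma nested_of_mem_nestedCandidates_aux (h : A ∈ nestedCandidates k l N X Y)
    (h' : C ∈ nestedCandidates k l N X' Y')
    (hm : ∀ E ∈ nestedCandidates k l N X Y, A.crossNumber ≤ E.crossNumber)
    (hm' : ∀ E ∈ nestedCandidates k l N X' Y', C.crossNumber ≤ E.crossNumber)
    (hY : Y ⊆ C.right) (hX' : X' ⊆ A.left) : A.Nested C := by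
  by_contra hn
  obtain ⟨⟨h1, h2⟩, h3, h4⟩ := h.1.corner h'.1 hY hX'
  have h5 := hm _ ⟨h1, h2.trans h.2.1, fun E hE => .corner hn (h.2.2 E hE) (h'.2.2 E hE)⟩
  have h6 := hm' _ ⟨h3, h4.trans h'.2.1, fun E hE => Nested.inv_right <|
    .corner (not_nested_inv_inv hn) (h.2.2 E hE).inv_right (h'.2.2 E hE).inv_right⟩
  rw [crossNumber_inv] at h6
  have := crossNumber_corner_add_lt hn
  omega

/-- The position in which corners do not help directly. Here C is also a candidate for X, Y, and
A.inv for X', Y'. Minimality of C bounds its crossing number by that of A, so C is minimal for X, Y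
as well and the corner argument applies with this one pair for both. -/
lemma nested_of_mem_nestedLayer_aux (h : A ∈ nestedCandidates k l N X Y)
    (h' : C ∈ nestedCandidates k l N X' Y')
    (hm : ∀ E ∈ nestedCandidates k l N X Y, A.crossNumber ≤ E.crossNumber)
    (hm' : ∀ E ∈ nestedCandidates k l N X' Y', C.crossNumber ≤ E.crossNumber)
    (hX : X ⊆ C.left) (hY : Y ⊆ C.right) (hX' : X' ⊆ A.right) (hY' : Y' ⊆ A.left) :
    A.Nested C := by
  have hC : C ∈ nestedCandidates k l N X Y :=
    ⟨h.1.of_order_le (by rw [h.2.1, h'.2.1]) hX hY, h'.2⟩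
  have hA : A.inv ∈ nestedCandidates k l N X' Y' :=
    ⟨h'.1.of_order_le (by rw [order_inv, h.2.1, h'.2.1]) hX' hY',
      (inv_mem_nestedCandidates h).2⟩
  have hCA := hm' _ hA
  rw [crossNumber_inv] at hCA
  exact nested_of_mem_nestedCandidates_aux h hC hm (fun E hE => hCA.trans (hm E hE)) hY
    h.1.subset_left

lemma nested_of_mem_nestedLayer (hA : A ∈ nestedLayer k l N) (hC : C ∈ nestedLayer k l N) :
    A.Nested C := by
  obtain ⟨X, Y, h, hm⟩ := hA
  obtain ⟨X', Y', h', hm'⟩ := hC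
  have hi := inv_mem_nestedCandidates h
  have hi' := inv_mem_nestedCandidates h'
  have hmi : ∀ E ∈ nestedCandidates k l N Y X, A.inv.crossNumber ≤ E.crossNumber :=
    fun E hE => by
      rw [crossNumber_inv, ← crossNumber_inv E]; exact hm _ (inv_mem_nestedCandidates hE)
  have hmi' : ∀ E ∈ nestedCandidates k l N Y' X', C.inv.crossNumber ≤ E.crossNumber :=
    fun E hE => by
      rw [crossNumber_inv, ← crossNumber_inv E]; exact hm' _ (inv_mem_nestedCandidates hE)
  have n1 := nested_of_mem_nestedCandidates_aux h h' hm hm'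
  have n2 := fun a b => (nested_of_mem_nestedCandidates_aux hi h' hmi hm' a b).inv_left
  have n3 := fun a b => (nested_of_mem_nestedCandidates_aux h hi' hm hmi' a b).inv_right
  have n4 := fun a b =>
    (nested_of_mem_nestedCandidates_aux hi hi' hmi hmi' a b).inv_left.inv_right
  have m1 := nested_of_mem_nestedLayer_aux h h' hm hm'
  have m2 := fun a b c d => (nested_of_mem_nestedLayer_aux h hi' hm hmi' a b c d).inv_right
  simp only [inv_left, inv_right, inv_inv] at n2 n3 n4 m1 m2
  have o1 := h.1.isKBlock_left.subset_left_or_right h'.1.order_lt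
  have o2 := h.1.isKBlock_right.subset_left_or_right h'.1.order_lt
  have o3 := h'.1.isKBlock_left.subset_left_or_right h.1.order_lt
  have o4 := h'.1.isKBlock_right.subset_left_or_right h.1.order_lt
  -- The first four alternatives are the corner argument for A and C up to inverses. Where none
  -- applies, A and C each separate both pairs of blocks, which is the case of `m1` or `m2`.
  rcases o1 with o1 | o1 <;> rcases o2 with o2 | o2 <;> rcases o3 with o3 | o3 <;>
    rcases o4 with o4 | o4 <;> first
    | exact n1 o2 o3
    | exact n2 o1 o3
    | exact n3 o2 o4
    | exact n4 o1 o4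
    | exact m1 o1 o2 o3 o4
    | exact m2 o1 o2 o4 o3

end

section

variable {l : ℕ} {A C : GraphSep G}

lemma inv_mem_nestedSeps (h : A ∈ nestedSeps G k l) : A.inv ∈ nestedSeps G k l := by
  induction l with
  | zero => exact h
  | succ l ih => exact h.imp ih inv_mem_nestedLayer

lemma map_mem_nestedSeps (φ : G ≃g G) (h : A ∈ nestedSeps G k l) :
    A.map φ ∈ nestedSeps G k l := by
  induction l generalizing A φ with
  | zero => exact h.elim
  | succ l ih => exact h.imp (ih φ) (map_mem_nestedLayer (fun φ _ h => ih φ h) φ)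

lemma exists_isEfficient_of_mem_nestedSeps (h : A ∈ nestedSeps G k l) :
    ∃ X Y, A.IsEfficient k X Y ∧ A.order < l := by
  induction l with
  | zero => exact h.elim
  | succ l ih =>
    rcases h with h | ⟨X, Y, h, -⟩
    · obtain ⟨X, Y, h1, h2⟩ := ih h
      exact ⟨X, Y, h1, h2.trans l.lt_succ_self⟩
    · exact ⟨X, Y, h.1, h.2.1 ▸ l.lt_succ_self⟩

variable [Finite V]

lemma nested_of_mem_nestedSeps (h : A ∈ nestedSeps G k l) (h' : C ∈ nestedSeps G k l) :
    A.Nested C := by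
  induction l with
  | zero => exact h.elim
  | succ l ih =>
    rcases h with h | h <;> rcases h' with h' | h'
    · exact ih h h'
    · obtain ⟨X, Y, h', -⟩ := h'
      exact h'.2.2 A h
    · obtain ⟨X, Y, h, -⟩ := h
      exact (h.2.2 C h').symm
    · exact nested_of_mem_nestedLayer h h'

/-- The order of C is less than l, the least order separating X from Y, so X and Y lie on one side
of C. The witness is a corner of C with A or A.inv; the position of X' decides which, so that the
opposite corner still separates X' from Y'. -/
lemma exists_isEfficient_crossing_less {X Y : Set V} (h : A.IsEfficient k X Y)
    (hA : A.order = l) (hC : C ∈ nestedSeps G k l) (hn : ¬ C.Nested A) :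
    ∃ E : GraphSep G, E.IsEfficient k X Y ∧ E.order = l ∧ C.Nested E ∧
      ∀ F : GraphSep G, F.Nested C → F.Nested A → F.Nested E := by
  wlog hXC : X ⊆ C.right generalizing C with H
  · obtain ⟨X', Y', h', hl⟩ := exists_isEfficient_of_mem_nestedSeps hC
    obtain ⟨E, h1, h2, h3, h4⟩ := H (inv_mem_nestedSeps hC) (fun h => hn h.inv_left)
      ((h.isKBlock_left.subset_left_or_right h'.order_lt).resolve_right hXC)
    exact ⟨E, h1, h2, h3.inv_left, fun F hF => h4 F hF.inv_right⟩
  obtain ⟨X', Y', h', hl⟩ := exists_isEfficient_of_mem_nestedSeps hC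
  have hn' : ¬ A.Nested C := fun h => hn h.symm
  have hYC : Y ⊆ C.right :=
    (h.isKBlock_right.subset_left_or_right h'.order_lt).resolve_left fun hY =>
      absurd (h.order_le C.inv hXC hY) (by rw [order_inv]; omega)
  rcases h'.isKBlock_left.subset_left_or_right h.order_lt with hX' | hX'
  · obtain ⟨⟨h1, h2⟩, -⟩ := h.corner h' hYC hX'
    refine ⟨_, h1, h2.trans hA, ?_, fun F h3 h4 => .corner hn' h4 h3⟩
    rw [corner_comm]
    exact .corner_of_le (Or.inl le_rfl)
  · obtain ⟨⟨h1, h2⟩, -⟩ := h.inv.corner h' hXC hX'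
    refine ⟨_, h1.inv, by rw [order_inv, h2, order_inv, hA], ?_, fun F h3 h4 =>
      Nested.inv_right (.corner (fun h => hn' (Nested.inv_left (A := A.inv) h)) h4.inv_right h3)⟩
    rw [corner_comm]
    exact Nested.inv_right (.corner_of_le (Or.inl le_rfl))

/-- An efficient separation crossing fewest earlier ones crosses none: a corner with a crossed C
becomes nested with C and acquires no new crossings among the earlier ones. -/
lemma nestedCandidates_nonempty {X Y : Set V} (h : A.IsEfficient k X Y) (hA : A.order = l) :
    (nestedCandidates k l (nestedSeps G k l) X Y).Nonempty := by
  obtain ⟨E, ⟨hE, hEl⟩, hmin⟩ := Set.exists_min_image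
    {E : GraphSep G | E.IsEfficient k X Y ∧ E.order = l}
    (fun E => {C ∈ nestedSeps G k l | ¬ C.Nested E}.ncard) (Set.toFinite _) ⟨A, h, hA⟩
  refine ⟨E, hE, hEl, ?_⟩
  by_contra! hn
  obtain ⟨C, hC, hn⟩ := hn
  obtain ⟨F, h1, h2, h3, h4⟩ := exists_isEfficient_crossing_less hE hEl hC hn
  refine (hmin F ⟨h1, h2⟩).not_gt (Set.ncard_lt_ncard ⟨fun D hD => ⟨hD.1, fun hD' =>
    hD.2 (h4 D (nested_of_mem_nestedSeps hD.1 hC) hD')⟩, fun hs => ?_⟩ (Set.toFinite _))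
  exact (hs (a := C) ⟨hC, hn⟩).2 h3

lemma exists_mem_nestedSeps {X Y : Set V} (hX : IsKBlock G k X) (hY : IsKBlock G k Y)
    (hXY : X ≠ Y) : ∃ A ∈ nestedSeps G k k, X ⊆ A.left ∧ Y ⊆ A.right := by
  obtain ⟨A₀, h₀, h₀X, h₀Y⟩ := hX.exists_separation hY hXY
  obtain ⟨A, hA, hmin⟩ := exists_minimum_order
    (Q := {A : GraphSep G | X ⊆ A.left ∧ Y ⊆ A.right}) ⟨A₀, h₀X, h₀Y⟩
  have hk : A.order < k := (hmin A₀ ⟨h₀X, h₀Y⟩).trans_lt h₀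
  have hE : A.IsEfficient k X Y := ⟨hX, hY, hk, hA.1, hA.2, fun E h1 h2 => hmin E ⟨h1, h2⟩⟩
  obtain ⟨C, hC, hCmin⟩ := Set.exists_min_image _ crossNumber (Set.toFinite _)
    (nestedCandidates_nonempty hE rfl)
  have hmono : Monotone (nestedSeps G k) := monotone_nat_of_le_succ fun _ => Set.subset_union_left
  exact ⟨C, hmono (Nat.succ_le_of_lt hk) (Or.inr ⟨X, Y, hC, hCmin⟩), hC.1.subset_left,
    hC.1.subset_right⟩

end

end NestedSet

/-! ### Trees recognised by their edge cuts -/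

namespace SimpleGraph

variable {W : Type*} {H : SimpleGraph W} {a b : W} {U : Set W}

lemma mem_of_reachable_deleteEdges
    (hcut : ∀ x y, H.Adj x y → x ∈ U → y ∉ U → x = a ∧ y = b) {x y : W}
    (h : (H.deleteEdges {s(a, b)}).Reachable x y) (hx : x ∈ U) : y ∈ U := by
  obtain ⟨p⟩ := h
  induction p with
  | nil => exact hx
  | @cons u v w huv p ih =>
    refine ih ?_
    by_contra hv
    rw [deleteEdges_adj] at huv
    obtain ⟨rfl, rfl⟩ := hcut _ _ huv.1 hx hv
    exact huv.2 rfl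

/-- If `ab` is the only edge leaving `U`, then `U` is the component of `H - ab` containing `a`. -/
lemma reachable_deleteEdges_iff (hH : H.Preconnected) (ha : a ∈ U) (hb : b ∉ U)
    (hcut : ∀ x y, H.Adj x y → x ∈ U → y ∉ U → x = a ∧ y = b) {x : W} :
    (H.deleteEdges {s(a, b)}).Reachable a x ↔ x ∈ U := by
  refine ⟨fun h => mem_of_reachable_deleteEdges hcut h ha, fun hx => ?_⟩
  obtain ⟨p⟩ := hH x b
  induction p with
  | nil => exact (hb hx).elim
  | @cons u v w huv p ih =>
    by_cases hv : v ∈ U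
    · refine (ih hb hcut hv).trans (Adj.reachable ?_)
      rw [deleteEdges_adj]
      refine ⟨huv.symm, fun h => hb ?_⟩
      have h : s(v, u) = s(a, w) := h
      rcases Sym2.eq_iff.1 h with h | h
      · exact h.2 ▸ hx
      · exact h.1 ▸ hv
    · rw [(hcut _ _ huv hx hv).1]

lemma isTree_of_forall_exists_cut (hH : H.Connected)
    (h : ∀ a b, H.Adj a b → ∃ U : Set W, a ∈ U ∧ b ∉ U ∧
      ∀ x y, H.Adj x y → x ∈ U → y ∉ U → x = a ∧ y = b) : H.IsTree where
  connected := hH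
  isAcyclic := by
    rw [isAcyclic_iff_forall_adj_isBridge]
    intro a b hab
    obtain ⟨U, ha, hb, hcut⟩ := h a b hab
    rw [isBridge_iff]
    exact fun h => hb (mem_of_reachable_deleteEdges hcut h ha)

lemma IsTree.not_reachable_deleteEdges (hH : H.IsTree) (hab : H.Adj a b) :
    ¬ (H.deleteEdges {s(a, b)}).Reachable a b :=
  isBridge_iff.1 (isAcyclic_iff_forall_adj_isBridge.1 hH.isAcyclic hab)

lemma exists_adj_reachable_deleteEdges (hH : H.Preconnected) {x : W} (hx : x ≠ a) :
    ∃ b, H.Adj a b ∧ (H.deleteEdges {s(b, a)}).Reachable b x := by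
  classical
  obtain ⟨p, hp⟩ := (hH a x).exists_isPath
  cases p with
  | nil => exact (hx rfl).elim
  | @cons _ b _ hab q =>
    refine ⟨b, hab, ⟨q.toDeleteEdge _ ?_⟩⟩
    have := hp.isTrail.edges_nodup
    rw [Walk.edges_cons, List.nodup_cons, Sym2.eq_swap] at this
    exact this.1

end SimpleGraph

/-! ### Tree-decompositions described by the sides of tree-edges -/

namespace TreeDecomp

variable {V : Type*} {G : SimpleGraph V} {T : Type*}

/-- A tree-decomposition from a tree in which both sides of every edge meet in its end parts. -/
def ofSides (tree : SimpleGraph T) (isTree : tree.IsTree) (part : T → Set V)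
    (vertex_mem : ∀ v : V, ∃ t, v ∈ part t)
    (edge_mem : ∀ u v : V, G.Adj u v → ∃ t, u ∈ part t ∧ v ∈ part t)
    (side_inter : ∀ s t, tree.Adj s t → ∀ v,
      (∃ u, (tree.deleteEdges {s(s, t)}).Reachable s u ∧ v ∈ part u) →
      (∃ u, (tree.deleteEdges {s(s, t)}).Reachable t u ∧ v ∈ part u) → v ∈ part s) :
    TreeDecomp G T where
  tree := tree
  isTree := isTree
  part := part
  vertex_mem := vertex_mem
  edge_mem := edge_mem
  inter_subset r t p hp s hs v hv := by
    classical
    rw [← p.take_spec hs] at hp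
    generalize p.takeUntil s hs = p₁ at hp
    generalize p.dropUntil s hs = p₂ at hp
    cases p₂ with
    | nil => exact hv.2
    | @cons _ y _ hsy q =>
      -- Deleting the path's edge from s to its successor y leaves r on the side of s and t on the
      -- side of y, so the condition at this edge applies.
      have := hp.isTrail.edges_nodup
      rw [SimpleGraph.Walk.edges_append, SimpleGraph.Walk.edges_cons, List.nodup_append] at this
      obtain ⟨-, h2, h3⟩ := this
      rw [List.nodup_cons] at h2
      exact side_inter s y hsy v
        ⟨r, SimpleGraph.Reachable.symm ⟨p₁.toDeleteEdge _ fun h => h3 _ h _ (by simp) rfl⟩, hv.1⟩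
        ⟨t, ⟨q.toDeleteEdge _ h2.1⟩, hv.2⟩

variable (D : TreeDecomp G T) {s t : T}

lemma part_subset_side (s t : T) : D.part s ⊆ D.side s t := fun _ hv => ⟨s, .rfl, hv⟩

lemma side_inter_subset (h : D.tree.Adj s t) : D.side s t ∩ D.side t s ⊆ D.part s := by
  classical
  rintro v ⟨⟨u, hu, hvu⟩, w, hw, hvw⟩
  obtain ⟨p, hp⟩ := (D.isTree.connected.preconnected u w).exists_isPath
  refine D.inter_subset u w p hp s ?_ ⟨hvu, hvw⟩
  by_contra hs
  refine D.isTree.not_reachable_deleteEdges h ?_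
  rw [Sym2.eq_swap (a := t)] at hw
  exact (hu.trans ⟨p.toDeleteEdge _ fun h => hs (p.fst_mem_support_of_mem_edges h)⟩).trans hw.symm

lemma exists_mem_side_of_not_mem_part {v : V} (hv : v ∉ D.part t) :
    ∃ s, D.tree.Adj t s ∧ v ∈ D.side s t ∧ v ∉ D.side t s := by
  obtain ⟨u, hu⟩ := D.vertex_mem v
  obtain ⟨s, hs, h⟩ := SimpleGraph.exists_adj_reachable_deleteEdges
    D.isTree.connected.preconnected (a := t) (x := u) (fun h => hv (h ▸ hu))
  exact ⟨s, hs, ⟨u, h, hu⟩, fun h' => hv (D.side_inter_subset hs ⟨h', u, h, hu⟩)⟩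

lemma part_subset_side_of_ne {u : T} (hu : u ≠ t) :
    ∃ s, D.tree.Adj t s ∧ D.part u ⊆ D.side s t := by
  obtain ⟨s, hs, h⟩ := SimpleGraph.exists_adj_reachable_deleteEdges
    D.isTree.connected.preconnected hu
  exact ⟨s, hs, fun v hv => ⟨u, h, hv⟩⟩

end TreeDecomp

/-! ### Consistent orientations of a nested set -/

open GraphSep

/-- A consistent orientation of a set `N` of separations: it contains one of each inverse pair and
is down-closed. -/
structure IsOrientation {V : Type*} {G : SimpleGraph V} (N o : Set (GraphSep G)) : Prop where
  subset : o ⊆ N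
  total : ∀ A ∈ N, A ∈ o ∨ A.inv ∈ o
  inv_not_mem : ∀ A ∈ o, A.inv ∉ o
  mem_of_le : ∀ A ∈ o, ∀ C ∈ N, C ≤ A → C ∈ o

namespace IsOrientation

variable {V : Type*} {G : SimpleGraph V} {N o p : Set (GraphSep G)} {A : GraphSep G}

lemma eq_of_subset (ho : IsOrientation N o) (hp : IsOrientation N p) (h : o ⊆ p) : o = p := by
  refine h.antisymm fun A hA => (ho.total A (hp.subset hA)).resolve_right fun h' => ?_
  exact hp.inv_not_mem A hA (h h')

/-- The elementary move along a tree-edge. If E lies below A.inv, then E.inv lies above A, so by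
maximality either E.inv is A or E.inv is not in o; this is what keeps the result down-closed. -/
lemma flip (hN : ∀ A ∈ N, A.IsProper) (hinv : ∀ A ∈ N, A.inv ∈ N) (ho : IsOrientation N o)
    (hA : Maximal (· ∈ o) A) : IsOrientation N (insert A.inv (o \ {A})) where
  subset := Set.insert_subset (hinv A (ho.subset hA.prop)) (Set.sdiff_subset.trans ho.subset)
  total C hC := by
    rcases ho.total C hC with h | h
    · by_cases hCA : C = A
      · exact Or.inr (Or.inl (by rw [hCA]))
      · exact Or.inl (Or.inr ⟨h, hCA⟩)
    · by_cases hCA : C.inv = A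
      · exact Or.inl (Or.inl (by rw [← hCA]; rfl))
      · exact Or.inr (Or.inr ⟨h, hCA⟩)
  inv_not_mem := by
    have hne := (hN A (ho.subset hA.prop)).inv_ne
    rintro C (rfl | ⟨hC, hCA⟩) (h | ⟨h, hn⟩)
    · exact hne h.symm
    · exact hn rfl
    · exact hCA (congrArg GraphSep.inv h)
    · exact ho.inv_not_mem C hC h
  mem_of_le := by
    rintro C (rfl | ⟨hC, hCA⟩) E hE hle
    · rcases ho.total E hE with h | h
      · exact Or.inr ⟨h, fun h' : E = A => (hN E hE).1 (by subst h'; exact hle.1)⟩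
      · have := hA.eq_of_le h (le_inv hle)
        exact Or.inl (by rw [this]; rfl)
    · exact Or.inr ⟨ho.mem_of_le C hC E hE hle, fun h' : E = A =>
        hCA (by subst h'; exact (hA.eq_of_le hC hle).symm)⟩

/-- A consistent orientation of a nested set is determined by any of its maximal elements. -/
lemma subset_of_maximal (hinv : ∀ A ∈ N, A.inv ∈ N) (hnest : ∀ A ∈ N, ∀ C ∈ N, A.Nested C)
    (ho : IsOrientation N o) (hp : IsOrientation N p) (hA : Maximal (· ∈ o) A)
    (hA' : Maximal (· ∈ p) A) : o ⊆ p := by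
  intro C hC
  rcases hnest C (ho.subset hC) A (ho.subset hA.prop) with h | h | h | h
  · exact hp.mem_of_le A hA'.prop C (ho.subset hC) h
  · rw [← hA.eq_of_le hC h]; exact hA'.prop
  · refine (hp.total C (ho.subset hC)).resolve_right fun h' => ?_
    exact ho.inv_not_mem C hC (hA'.eq_of_le h' (le_inv h) ▸ hA.prop)
  · exact (ho.inv_not_mem A hA.prop
      (ho.mem_of_le C hC A.inv (hinv A (ho.subset hA.prop)) h)).elim

lemma eq_of_maximal (hinv : ∀ A ∈ N, A.inv ∈ N) (hnest : ∀ A ∈ N, ∀ C ∈ N, A.Nested C)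
    (ho : IsOrientation N o) (hp : IsOrientation N p) (hA : Maximal (· ∈ o) A)
    (hA' : Maximal (· ∈ p) A) : o = p :=
  (subset_of_maximal hinv hnest ho hp hA hA').antisymm
    (subset_of_maximal hinv hnest hp ho hA' hA)

/-- An orientation can be moved, without reversing separations that have `Q` on the right, to one
all of whose separations have `Q` on the right. -/
lemma exists_subset_right [Finite V] (hN : ∀ A ∈ N, A.IsProper) (hinv : ∀ A ∈ N, A.inv ∈ N)
    (ho : IsOrientation N o) {Q : Set V} (hQ : ∀ A ∈ N, Q ⊆ A.left ∨ Q ⊆ A.right) :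
    ∃ p, IsOrientation N p ∧ (∀ A ∈ p, Q ⊆ A.right) ∧ ∀ A ∈ o, Q ⊆ A.right → A ∈ p := by
  induction hn : {A ∈ o | ¬ Q ⊆ A.right}.ncard using Nat.strong_induction_on generalizing o with
  | _ n ih =>
    by_cases hne : ∃ A ∈ o, ¬ Q ⊆ A.right
    · obtain ⟨A₀, hA₀⟩ := hne
      -- Everything in o above an offending separation is offending too, so a maximal offender is
      -- maximal in o and can be flipped. This reduces the number of offenders.
      obtain ⟨A, -, hA⟩ := Set.Finite.exists_le_maximal
        (s := {A ∈ o | ¬ Q ⊆ A.right}) (Set.toFinite _) hA₀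
      have hmax : Maximal (· ∈ o) A := ⟨hA.prop.1, fun C hC hle =>
        hA.le_of_ge ⟨hC, fun h => hA.prop.2 (h.trans hle.2)⟩ hle⟩
      have hQA : Q ⊆ A.left := (hQ A (ho.subset hA.prop.1)).resolve_right hA.prop.2
      obtain ⟨p, hp, hp1, hp2⟩ := ih _ (by
        rw [← hn]
        refine Set.ncard_lt_ncard ⟨?_, fun hs => ?_⟩ (Set.toFinite _)
        · rintro C ⟨rfl | hC, h⟩
          · exact (h hQA).elim
          · exact ⟨hC.1, h⟩
        · rcases hs hA.prop with ⟨h | h, h'⟩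
          · exact h' (h.symm ▸ hQA)
          · exact h.2 rfl) (ho.flip hN hinv hmax) rfl
      exact ⟨p, hp, hp1, fun C hC hCQ => hp2 C (Or.inr ⟨hC, fun h : C = A =>
        hA.prop.2 (h ▸ hCQ)⟩) hCQ⟩
    · push Not at hne
      exact ⟨o, ho, hne, fun A hA _ => hA⟩

lemma map (hinv : ∀ (φ : G ≃g G), ∀ A ∈ N, A.map φ ∈ N) (ho : IsOrientation N o) (φ : G ≃g G) :
    IsOrientation N (GraphSep.map φ '' o) where
  subset := by
    rintro _ ⟨A, hA, rfl⟩
    exact hinv φ A (ho.subset hA)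
  total A hA := by
    rcases ho.total _ (hinv φ.symm A hA) with h | h
    · exact Or.inl ⟨_, h, map_map_symm φ A⟩
    · exact Or.inr ⟨_, h, by rw [map_inv, map_map_symm]⟩
  inv_not_mem := by
    rintro _ ⟨A, hA, rfl⟩ ⟨C, hC, h⟩
    rw [← map_inv] at h
    exact ho.inv_not_mem A hA (map_injective φ h ▸ hC)
  mem_of_le := by
    rintro _ ⟨A, hA, rfl⟩ C hC hle
    rw [← map_map_symm φ C] at hle ⊢
    exact ⟨_, ho.mem_of_le A hA _ (hinv φ.symm C hC) ((map_le_map_iff φ).1 hle), rfl⟩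

end IsOrientation

/-- Two orientations of `N` are adjacent if they differ on exactly one separation. -/
def orientationGraph {V : Type*} {G : SimpleGraph V} (N : Set (GraphSep G)) :
    SimpleGraph {o // IsOrientation N o} where
  Adj o p := ∃ A ∈ o.1, A.inv ∈ p.1 ∧ ∀ C, C ≠ A → C ≠ A.inv → (C ∈ o.1 ↔ C ∈ p.1)
  symm := ⟨fun _ _ ⟨A, h1, h2, h3⟩ => ⟨A.inv, h2, h1, fun C h4 h5 => (h3 C h5 h4).symm⟩⟩
  loopless := ⟨fun o ⟨A, h1, h2, _⟩ => o.2.inv_not_mem A h1 h2⟩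

/-! ### The tree of orientations and its tree-decomposition -/

section OrientationTree

variable {V : Type*} {G : SimpleGraph V} {N : Set (GraphSep G)}

lemma maximal_of_agree {o p : {o // IsOrientation N o}} {A : GraphSep G} (h1 : A ∈ o.1)
    (h2 : A.inv ∈ p.1) (h3 : ∀ C, C ≠ A → C ≠ A.inv → (C ∈ o.1 ↔ C ∈ p.1)) :
    Maximal (· ∈ o.1) A := by
  refine ⟨h1, fun C hC hle => ?_⟩
  by_contra hn
  have hCA : C ≠ A := fun h => hn h.le
  have hCp := (h3 C hCA fun h => o.2.inv_not_mem A h1 (h ▸ hC)).1 hC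
  exact p.2.inv_not_mem A (p.2.mem_of_le C hCp A (o.2.subset h1) hle) h2

/-- An edge leaving this set of orientations must reverse A itself. So A is maximal at its one end
and A.inv at the other, and a maximal element determines the orientation. -/
lemma orientationGraph_cut (hinv : ∀ A ∈ N, A.inv ∈ N) (hnest : ∀ A ∈ N, ∀ C ∈ N, A.Nested C)
    {o p : {o // IsOrientation N o}} {A : GraphSep G} (h1 : A ∈ o.1)
    (h2 : A.inv ∈ p.1) (h3 : ∀ C, C ≠ A → C ≠ A.inv → (C ∈ o.1 ↔ C ∈ p.1))
    (x y : {o // IsOrientation N o}) (hxy : (orientationGraph N).Adj x y)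
    (hx : x ∈ {q | A ∈ q.1}) (hy : y ∉ {q | A ∈ q.1}) : x = o ∧ y = p := by
  obtain ⟨C, k1, k2, k3⟩ := hxy
  have hA : A = C := by
    by_contra hne
    exact hy ((k3 A hne fun h => x.2.inv_not_mem C k1 (h ▸ hx)).1 hx)
  subst hA
  exact ⟨Subtype.ext (x.2.eq_of_maximal hinv hnest o.2 (maximal_of_agree k1 k2 k3)
      (maximal_of_agree h1 h2 h3)),
    Subtype.ext (y.2.eq_of_maximal hinv hnest p.2
      (maximal_of_agree k2 k1 fun C a b => (k3 C b a).symm)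
      (maximal_of_agree h2 h1 fun C a b => (h3 C b a).symm))⟩

/-- A maximal element of o \ p is maximal in o because p is down-closed; flipping it brings o closer
to p. -/
lemma orientationGraph_preconnected [Finite V] (hN : ∀ A ∈ N, A.IsProper)
    (hinv : ∀ A ∈ N, A.inv ∈ N) : (orientationGraph N).Preconnected := by
  intro o p
  induction hn : (o.1 \ p.1).ncard using Nat.strong_induction_on generalizing o with
  | _ n ih =>
    by_cases hne : (o.1 \ p.1).Nonempty
    · obtain ⟨A₀, hA₀⟩ := hne
      obtain ⟨A, -, hA⟩ := Set.Finite.exists_le_maximal (Set.toFinite _) hA₀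
      have hmax : Maximal (· ∈ o.1) A := ⟨hA.prop.1, fun C hC hle =>
        hA.le_of_ge ⟨hC, fun h => hA.prop.2
          (p.2.mem_of_le C h A (o.2.subset hA.prop.1) hle)⟩ hle⟩
      have hAp := (p.2.total A (o.2.subset hA.prop.1)).resolve_left hA.prop.2
      refine SimpleGraph.Reachable.trans (SimpleGraph.Adj.reachable ?_)
        (ih _ ?_ ⟨_, o.2.flip hN hinv hmax⟩ rfl)
      · exact ⟨A, hA.prop.1, Or.inl rfl, fun C h1 h2 =>
          ⟨fun h => Or.inr ⟨h, h1⟩, fun h => (h.resolve_left h2).1⟩⟩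
      · rw [← hn]
        refine Set.ncard_lt_ncard ⟨?_, fun hs => ?_⟩ (Set.toFinite _)
        · rintro C ⟨rfl | hC, h⟩
          · exact (h hAp).elim
          · exact ⟨hC.1, h⟩
        · rcases hs hA.prop with ⟨h | h, -⟩
          · exact hA.prop.2 (h.symm ▸ hAp)
          · exact h.2 rfl
    · rw [Set.not_nonempty_iff_eq_empty, Set.sdiff_eq_empty] at hne
      rw [Subtype.ext (o.2.eq_of_subset p.2 hne)]

variable [Finite V] (hN : ∀ A ∈ N, A.IsProper) (hinv : ∀ A ∈ N, A.inv ∈ N)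
  (hnest : ∀ A ∈ N, ∀ C ∈ N, A.Nested C)

-- To find a part containing v on the side of o, push o towards v. This never reverses a separation
-- with v on its right, so A survives and the deleted edge is not crossed.
include hN hinv hnest in
lemma orientationGraph_side {o p : {o // IsOrientation N o}} {A : GraphSep G} (h1 : A ∈ o.1)
    (h2 : A.inv ∈ p.1) (h3 : ∀ C, C ≠ A → C ≠ A.inv → (C ∈ o.1 ↔ C ∈ p.1)) (v : V) :
    (∃ u, ((orientationGraph N).deleteEdges {s(o, p)}).Reachable o u ∧
      v ∈ ⋂ C ∈ u.1, C.right) ↔ v ∈ A.right := by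
  have key := fun x => SimpleGraph.reachable_deleteEdges_iff (x := x)
    (orientationGraph_preconnected hN hinv) (U := {q | A ∈ q.1}) h1
    (fun h => p.2.inv_not_mem A h h2) (orientationGraph_cut hinv hnest h1 h2 h3)
  constructor
  · rintro ⟨u, hu, hv⟩
    exact Set.mem_iInter₂.1 hv A ((key u).1 hu)
  · intro hv
    obtain ⟨q, hq, hq1, hq2⟩ := o.2.exists_subset_right hN hinv (Q := {v}) fun C _ => by
      simpa using C.mem_left_or_mem_right v
    exact ⟨⟨q, hq⟩, (key _).2 (hq2 A h1 (by simpa using hv)),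
      Set.mem_iInter₂.2 fun C hC => by simpa using hq1 C hC⟩

/-- The tree-decomposition whose tree-edges induce the separations in a nested set `N`. -/
def orientationTreeDecomp (o₀ : {o // IsOrientation N o}) :
    TreeDecomp G {o // IsOrientation N o} :=
  .ofSides (orientationGraph N)
    (SimpleGraph.isTree_of_forall_exists_cut
      { preconnected := orientationGraph_preconnected hN hinv, nonempty := ⟨o₀⟩ }
      fun o p ⟨A, h1, h2, h3⟩ => ⟨{q | A ∈ q.1}, h1, fun h => p.2.inv_not_mem A h h2,
        orientationGraph_cut hinv hnest h1 h2 h3⟩)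
    (fun o => ⋂ C ∈ o.1, C.right)
    (fun v => by
      obtain ⟨q, hq, hq1, -⟩ := o₀.2.exists_subset_right hN hinv (Q := {v}) fun C _ => by
        simpa using C.mem_left_or_mem_right v
      exact ⟨⟨q, hq⟩, Set.mem_iInter₂.2 fun C hC => by simpa using hq1 C hC⟩)
    (fun u v huv => by
      -- The ends of an edge are never strictly on different sides of a separation, so {u, v} lies
      -- in one side of every C.
      obtain ⟨q, hq, hq1, -⟩ := o₀.2.exists_subset_right hN hinv (Q := {u, v}) fun C _ => by
        have h1 := C.mem_left_or_mem_right u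
        have h2 := C.mem_left_or_mem_right v
        have h3 := C.not_adj u
        have h4 := C.not_adj v
        simp only [Set.insert_subset_iff, Set.singleton_subset_iff, Set.mem_sdiff] at *
        by_contra! hn
        rcases h1 with h1 | h1
        · exact h3 ⟨h1, fun h => (hn.2 h) (h2.resolve_left (hn.1 h1))⟩ v
            ⟨h2.resolve_left (hn.1 h1), hn.1 h1⟩ huv
        · exact h4 ⟨h2.resolve_right (hn.2 h1), hn.2 h1⟩ u
            ⟨h1, fun h => hn.1 h (h2.resolve_right (hn.2 h1))⟩ huv.symm
      exact ⟨⟨q, hq⟩, Set.mem_iInter₂.2 fun C hC => hq1 C hC (by simp),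
        Set.mem_iInter₂.2 fun C hC => hq1 C hC (by simp)⟩)
    (by
      rintro o p ⟨A, h1, h2, h3⟩ v hv hv'
      rw [orientationGraph_side hN hinv hnest h1 h2 h3] at hv
      rw [Sym2.eq_swap, orientationGraph_side hN hinv hnest h2 h1
        fun C a b => (h3 C b a).symm] at hv'
      have hmax := maximal_of_agree h1 h2 h3
      refine Set.mem_iInter₂.2 fun C hC => ?_
      -- Since v is in both sides of A, it suffices that C.right contains A.right or A.left. The
      -- nesting case that gives neither contradicts consistency of o.
      rcases hnest C (o.2.subset hC) A (o.2.subset h1) with h | h | h | h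
      · exact h.2 hv
      · exact hmax.eq_of_le hC h ▸ hv
      · exact h.2 hv'
      · exact (o.2.inv_not_mem A h1
          (o.2.mem_of_le C hC A.inv (hinv A (o.2.subset h1)) h)).elim)

lemma orientationTreeDecomp_part (o₀ o : {o // IsOrientation N o}) :
    (orientationTreeDecomp hN hinv hnest o₀).part o = ⋂ C ∈ o.1, C.right := rfl

lemma orientationTreeDecomp_edgesIn (o₀ : {o // IsOrientation N o}) :
    (orientationTreeDecomp hN hinv hnest o₀).EdgesIn N := by
  rintro o p ⟨A, h1, h2, h3⟩
  refine ⟨A.inv, hinv A (o.2.subset h1), Set.ext fun v =>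
    (orientationGraph_side hN hinv hnest h1 h2 h3 v).symm, Set.ext fun v =>
    (orientationGraph_side hN hinv hnest h2 h1 (fun C a b => (h3 C b a).symm) v).symm⟩

lemma orientationTreeDecomp_isCanonical (hmap : ∀ (φ : G ≃g G), ∀ A ∈ N, A.map φ ∈ N)
    (o₀ : {o // IsOrientation N o}) (S : Set (GraphSep G)) :
    (orientationTreeDecomp hN hinv hnest o₀).IsCanonical S := by
  intro φ _
  have hadj : ∀ (ψ : G ≃g G) (o p : {o // IsOrientation N o}), (orientationGraph N).Adj o p →
      (orientationGraph N).Adj ⟨_, o.2.map hmap ψ⟩ ⟨_, p.2.map hmap ψ⟩ := by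
    rintro ψ o p ⟨A, h1, h2, h3⟩
    have hmem : ∀ (q : Set (GraphSep G)) C, C ∈ map ψ '' q ↔ C.map ψ.symm ∈ q := fun q C =>
      ⟨by rintro ⟨E, hE, rfl⟩; rwa [map_symm_map], fun h => ⟨_, h, map_map_symm ψ C⟩⟩
    refine ⟨A.map ψ, ⟨A, h1, rfl⟩, ⟨A.inv, h2, rfl⟩, fun C h4 h5 => ?_⟩
    rw [hmem, hmem]
    refine h3 _ (fun h => h4 ?_) (fun h => h5 ?_)
    · rw [← h, map_map_symm]
    · rw [← map_inv, ← h, map_map_symm]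
  have hs : ∀ q : Set (GraphSep G), map φ.symm '' (map φ '' q) = q := fun q => by
    rw [Set.image_image]; simp only [map_symm_map, Set.image_id']
  have hs' : ∀ q : Set (GraphSep G), map φ '' (map φ.symm '' q) = q := fun q => by
    rw [Set.image_image]; simp only [map_map_symm, Set.image_id']
  refine ⟨⟨⟨fun o => ⟨_, o.2.map hmap φ⟩, fun o => ⟨_, o.2.map hmap φ.symm⟩,
    fun o => Subtype.ext (hs _), fun o => Subtype.ext (hs' _)⟩, ?_⟩, fun o => ?_⟩
  · intro o p
    refine ⟨fun h => ?_, hadj φ o p⟩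
    have := hadj φ.symm _ _ h
    simp only [Equiv.coe_fn_mk, hs] at this
    exact this
  · change ⋂ C ∈ map φ '' o.1, C.right = φ '' ⋂ C ∈ o.1, C.right
    rw [Set.biInter_image, Set.image_iInter φ.bijective]
    simp only [Set.image_iInter φ.bijective, map_right]

end OrientationTree

/-- There is a canonical tree-decomposition distinguishing all `k`-blocks. -/
lemma exists_treeDecomp_separatesBlocks {V : Type*} [Finite V] (G : SimpleGraph V) (k : ℕ)
    (S : Set (GraphSep G))
    (hS : ∀ A : GraphSep G, A.IsProper → A.order < k → A.IsTight → A ∈ S) :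
    ∃ D : TreeDecomp G {o // IsOrientation (nestedSeps G k k) o},
      D.IsCanonical S ∧ D.EdgesIn S ∧ D.SeparatesBlocks k := by
  have hN : ∀ A ∈ nestedSeps G k k, A.IsProper := fun A hA => by
    obtain ⟨X, Y, h, -⟩ := exists_isEfficient_of_mem_nestedSeps hA
    exact h.isProper
  have hk : ∀ A ∈ nestedSeps G k k, A.order < k := fun A hA => by
    obtain ⟨X, Y, -, h⟩ := exists_isEfficient_of_mem_nestedSeps hA
    exact h
  have hinv : ∀ A ∈ nestedSeps G k k, A.inv ∈ nestedSeps G k k := fun A => inv_mem_nestedSeps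
  have hX : ∀ X, IsKBlock G k X → IsOrientation (nestedSeps G k k)
      {A ∈ nestedSeps G k k | X ⊆ A.right} := fun X hX =>
    { subset := fun A hA => hA.1
      total := fun A hA => (hX.subset_left_or_right (hk A hA)).symm.imp
        (fun h => ⟨hA, h⟩) (fun h => ⟨hinv A hA, h⟩)
      inv_not_mem := fun A hA hA' => hX.not_subset_right (hk A hA.1) hA'.2 hA.2
      mem_of_le := fun A hA C hC hle => ⟨hC, hA.2.trans hle.2⟩ }
  -- A node is needed even if there are no blocks; with nothing to orient, the empty orientation
  -- serves.
  obtain ⟨o₀⟩ : Nonempty {o // IsOrientation (nestedSeps G k k) o} := by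
    rcases (nestedSeps G k k).eq_empty_or_nonempty with h | ⟨A, hA⟩
    · exact ⟨⟨∅, by simp, by simp [h], by simp, by simp⟩⟩
    · obtain ⟨X, Y, h, -⟩ := exists_isEfficient_of_mem_nestedSeps hA
      exact ⟨⟨_, hX X h.isKBlock_left⟩⟩
  refine ⟨orientationTreeDecomp hN hinv (fun A hA C hC => nested_of_mem_nestedSeps hA hC) o₀,
    orientationTreeDecomp_isCanonical _ _ _ (fun φ A hA => map_mem_nestedSeps φ hA) _ _, ?_,
    fun X h => ⟨⟨_, hX X h⟩, Set.subset_iInter₂ fun A hA => hA.2⟩, ?_⟩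
  · intro s t hst
    obtain ⟨A, hA, h⟩ := orientationTreeDecomp_edgesIn hN hinv
      (fun A hA C hC => nested_of_mem_nestedSeps hA hC) o₀ s t hst
    obtain ⟨X, Y, hE, -⟩ := exists_isEfficient_of_mem_nestedSeps hA
    exact ⟨A, hS A hE.isProper hE.order_lt hE.isTight, h⟩
  · intro X Y hX hY hXY s t hs ht hst
    rw [hst, orientationTreeDecomp_part, Set.subset_iInter₂_iff] at hs
    rw [orientationTreeDecomp_part, Set.subset_iInter₂_iff] at ht
    obtain ⟨A, hA, h1, h2⟩ := exists_mem_nestedSeps hX hY hXY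
    rcases t.2.total A hA with h | h
    · exact hX.not_subset_right (hk A hA) h1 (hs A h)
    · exact hY.not_subset_right (hk A hA) (ht _ h) h2

/-! ### Components after deleting an edge -/

namespace SimpleGraph

variable {W : Type*} {H : SimpleGraph W} {a b : W} {U : Set W}

lemma reachable_deleteEdges_iff_not_mem (hH : H.Preconnected) (ha : a ∈ U) (hb : b ∉ U)
    (hcut : ∀ x y, H.Adj x y → x ∈ U → y ∉ U → x = a ∧ y = b) {x : W} :
    (H.deleteEdges {s(b, a)}).Reachable b x ↔ x ∉ U :=
  reachable_deleteEdges_iff hH (U := Uᶜ) hb (not_not.2 ha) fun x y hxy hx hy =>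
    (hcut y x hxy.symm (not_not.1 hy) hx).symm

lemma reachable_deleteEdges_map {W' : Type*} {H' : SimpleGraph W'} (i : H ≃g H') {x y : W}
    (h : (H.deleteEdges {s(a, b)}).Reachable x y) :
    (H'.deleteEdges {s(i a, i b)}).Reachable (i x) (i y) := by
  let f : H.deleteEdges {s(a, b)} →g H'.deleteEdges {s(i a, i b)} :=
    { toFun := i
      map_rel' := fun {x y} hxy => by
        rw [deleteEdges_adj] at hxy ⊢
        refine ⟨i.map_adj_iff.2 hxy.1, fun he => hxy.2 ?_⟩
        exact Sym2.map.injective i.injective (he : s(i x, i y) = s(i a, i b)) }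
  exact h.map f

lemma eq_of_adj_of_reachable_deleteEdges (x y : W) (hxy : H.Adj x y)
    (hx : (H.deleteEdges {s(a, b)}).Reachable a x)
    (hy : ¬ (H.deleteEdges {s(a, b)}).Reachable a y) : x = a ∧ y = b := by
  by_cases he : s(x, y) = s(a, b)
  · rcases Sym2.eq_iff.1 he with h | h
    · exact h
    · exact (hy (h.2 ▸ .rfl)).elim
  · refine (hy (hx.trans (Adj.reachable ?_))).elim
    rw [deleteEdges_adj]
    exact ⟨hxy, he⟩

end SimpleGraph

/-! ### Refining a decomposition by replacing nodes with stars -/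

namespace TreeDecomp

open GraphSep

variable {V : Type*} {G : SimpleGraph V} {T : Type*} (D : TreeDecomp G T)

lemma image_map_symm_eq {S : Set (GraphSep G)} (φ : G ≃g G) (hφ : GraphSep.map φ '' S = S) :
    GraphSep.map φ.symm '' S = S := by
  conv_lhs => rw [← hφ]
  rw [Set.image_image]
  simp only [map_symm_map, Set.image_id']

/-- The pair induced by the oriented tree-edge `st` is at most `A`. -/
def EdgeLE (s t : T) (A : GraphSep G) : Prop := D.side s t ⊆ A.left ∧ A.right ⊆ D.side t s

/-- For each node `t`, a star `M t` of separations nested with the tree-edges at `t`. -/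
structure IsStarSystem (M : T → Set (GraphSep G)) : Prop where
  le_inv : ∀ t, ∀ A ∈ M t, ∀ C ∈ M t, A ≠ C → A ≤ C.inv
  edgeLE_or : ∀ t, ∀ A ∈ M t, ∀ s, D.tree.Adj t s → D.EdgeLE s t A ∨ D.EdgeLE s t A.inv
  not_subset : ∀ s t, D.tree.Adj s t → ¬ D.side s t ⊆ D.side t s

/-- The nodes of the tree obtained by replacing each node `t` by a star with leaves `M t`. -/
def StarNode (M : T → Set (GraphSep G)) : Type _ :=
  {x : T × Option (GraphSep G) // ∀ A ∈ x.2, A ∈ M x.1}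

instance [Finite T] [Finite V] (M : T → Set (GraphSep G)) : Finite (StarNode M) :=
  inferInstanceAs (Finite {x : T × Option (GraphSep G) // ∀ A ∈ x.2, A ∈ M x.1})

variable (M : T → Set (GraphSep G))

open Classical in
/-- The node of the star at `t` to which the former neighbour `s` of `t` gets attached. -/
noncomputable def attach (t s : T) : Option (GraphSep G) :=
  if h : ∃ A ∈ M t, D.EdgeLE s t A then some h.choose else none

lemma mem_of_mem_attach {t s : T} {A : GraphSep G} (h : A ∈ D.attach M t s) :
    A ∈ M t ∧ D.EdgeLE s t A := by
  unfold attach at h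
  split_ifs at h with h'
  · obtain rfl := Option.some.inj h
    exact h'.choose_spec
  · simp at h

/-- The centre of the star at `t`. -/
def starCenter (t : T) : StarNode M := ⟨(t, none), by simp⟩

/-- The leaf of the star at `t` that belongs to `A`. -/
def starLeaf {t : T} {A : GraphSep G} (hA : A ∈ M t) : StarNode M := ⟨(t, some A), by simpa⟩

/-- The tree obtained by replacing each node `t` by a star with leaves `M t`. -/
def starGraph : SimpleGraph (StarNode M) where
  Adj x y := (x.1.1 = y.1.1 ∧ (x.1.2 = none ∧ y.1.2 ≠ none ∨ x.1.2 ≠ none ∧ y.1.2 = none)) ∨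
    (D.tree.Adj x.1.1 y.1.1 ∧ x.1.2 = D.attach M x.1.1 y.1.1 ∧ y.1.2 = D.attach M y.1.1 x.1.1)
  symm := ⟨fun _ _ h => h.imp (fun h => ⟨h.1.symm, h.2.symm.imp And.symm And.symm⟩)
    fun h => ⟨h.1.symm, h.2.symm⟩⟩
  loopless := ⟨fun _ h => h.elim (fun h => h.2.elim (fun h => h.2 h.1) fun h => h.1 h.2)
    fun h => h.1.ne rfl⟩

/-- The parts of the refined tree-decomposition. -/
def starPart (x : StarNode M) : Set V :=
  D.part x.1.1 ∩ x.1.2.elim (⋂ A ∈ M x.1.1, A.right) GraphSep.left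

lemma starGraph_adj_cases {x y : StarNode M} (h : (D.starGraph M).Adj x y) :
    (∃ t, ∃ A, ∃ hA : A ∈ M t, x = starLeaf M hA ∧ y = starCenter M t) ∨
    (∃ t, ∃ A, ∃ hA : A ∈ M t, x = starCenter M t ∧ y = starLeaf M hA) ∨
    (D.tree.Adj x.1.1 y.1.1 ∧ x.1.2 = D.attach M x.1.1 y.1.1 ∧
      y.1.2 = D.attach M y.1.1 x.1.1) := by
  obtain ⟨⟨t, a⟩, ha⟩ := x
  obtain ⟨⟨s, b⟩, hb⟩ := y
  rcases h with ⟨rfl, ⟨h1, h2⟩ | ⟨h1, h2⟩⟩ | h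
  · obtain ⟨A, rfl⟩ := Option.ne_none_iff_exists'.1 h2
    dsimp only at h1
    subst h1
    exact Or.inr (Or.inl ⟨_, A, hb A rfl, rfl, rfl⟩)
  · obtain ⟨A, rfl⟩ := Option.ne_none_iff_exists'.1 h1
    dsimp only at h2
    subst h2
    exact Or.inl ⟨_, A, ha A rfl, rfl, rfl⟩
  · exact Or.inr (Or.inr h)

lemma starGraph_adj_leaf_center {t : T} {A : GraphSep G} (hA : A ∈ M t) :
    (D.starGraph M).Adj (starLeaf M hA) (starCenter M t) :=
  Or.inl ⟨rfl, Or.inr ⟨Option.some_ne_none A, rfl⟩⟩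

lemma starGraph_reachable_center (x : StarNode M) :
    (D.starGraph M).Reachable x (starCenter M x.1.1) := by
  obtain ⟨⟨t, _ | A⟩, ha⟩ := x
  · exact .rfl
  · exact (D.starGraph_adj_leaf_center M (ha A rfl)).reachable

/-- The node of the star at `t` to which `s` is attached. -/
noncomputable def attachNode (t s : T) : StarNode M :=
  ⟨(t, D.attach M t s), fun _ h => (D.mem_of_mem_attach M h).1⟩

lemma starGraph_adj_attachNode {s t : T} (h : D.tree.Adj s t) :
    (D.starGraph M).Adj (D.attachNode M s t) (D.attachNode M t s) :=
  Or.inr ⟨h, rfl, rfl⟩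

lemma starGraph_connected : (D.starGraph M).Connected where
  preconnected x y := by
    obtain ⟨p⟩ := D.isTree.connected.preconnected x.1.1 y.1.1
    refine (D.starGraph_reachable_center M x).trans (.trans ?_
      (D.starGraph_reachable_center M y).symm)
    generalize x.1.1 = u at p
    generalize y.1.1 = w at p
    induction p with
    | nil => exact .rfl
    | @cons u v w huv p ih =>
      exact ((D.starGraph_reachable_center M (D.attachNode M u v)).symm.trans
        ((D.starGraph_adj_attachNode M huv).reachable.trans
          (D.starGraph_reachable_center M (D.attachNode M v u)))).trans ih
  nonempty := D.isTree.connected.nonempty.map (starCenter M)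

/-- The side of the leaf in the edge joining the leaf of `A` to the centre of the star at `t`. -/
def leafCut (t : T) (A : GraphSep G) : Set (StarNode M) :=
  {z | (z.1.1 = t ∧ z.1.2 = some A) ∨ ∃ s, D.tree.Adj t s ∧ D.attach M t s = some A ∧
    (D.tree.deleteEdges {s(s, t)}).Reachable s z.1.1}

lemma starLeaf_mem_leafCut {t : T} {A : GraphSep G} (hA : A ∈ M t) :
    starLeaf M hA ∈ D.leafCut M t A := Or.inl ⟨rfl, rfl⟩

lemma starCenter_not_mem_leafCut (t : T) (A : GraphSep G) :
    starCenter M t ∉ D.leafCut M t A := by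
  rintro (⟨-, h⟩ | ⟨s, hs, -, h⟩)
  · simp [starCenter] at h
  · exact D.isTree.not_reachable_deleteEdges hs.symm h

/-- A branch behind the leaf can be left only through the edge back to t, and that edge ends at the
leaf of A, which belongs to the cut. -/
lemma leafCut_cut {t : T} {A : GraphSep G} (hA : A ∈ M t) (x y : StarNode M)
    (hxy : (D.starGraph M).Adj x y) (hx : x ∈ D.leafCut M t A) (hy : y ∉ D.leafCut M t A) :
    x = starLeaf M hA ∧ y = starCenter M t := by
  obtain ⟨⟨u, a⟩, ha⟩ := x
  obtain ⟨⟨w, b⟩, hb⟩ := y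
  rcases hx with ⟨hu, ha'⟩ | ⟨s, hs, hsA, hr⟩
  · dsimp only at hu ha'
    subst hu ha'
    rcases hxy with ⟨hw, h | h⟩ | h
    · simp at h
    · obtain ⟨-, h⟩ := h
      dsimp only at hw h
      subst hw h
      exact ⟨rfl, rfl⟩
    · exact (hy (Or.inr ⟨w, h.1, h.2.1.symm, .rfl⟩)).elim
  · rcases hxy with ⟨hw, -⟩ | h
    · dsimp only at hw
      subst hw
      exact (hy (Or.inr ⟨s, hs, hsA, hr⟩)).elim
    · have hnr : ¬ (D.tree.deleteEdges {s(s, t)}).Reachable s w := fun h' =>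
        hy (Or.inr ⟨s, hs, hsA, h'⟩)
      obtain ⟨h1, h2⟩ := SimpleGraph.eq_of_adj_of_reachable_deleteEdges u w h.1 hr hnr
      subst h1 h2
      exact (hy (Or.inl ⟨rfl, h.2.2.trans hsA⟩)).elim

lemma edgeCut_cut {x y : StarNode M}
    (hx : x.1.2 = D.attach M x.1.1 y.1.1) (hy : y.1.2 = D.attach M y.1.1 x.1.1) (z w : StarNode M)
    (hzw : (D.starGraph M).Adj z w)
    (hz : z ∈ {z : StarNode M |
      (D.tree.deleteEdges {s(x.1.1, y.1.1)}).Reachable x.1.1 z.1.1})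
    (hw : w ∉ {z : StarNode M |
      (D.tree.deleteEdges {s(x.1.1, y.1.1)}).Reachable x.1.1 z.1.1}) : z = x ∧ w = y := by
  rcases hzw with ⟨h, -⟩ | ⟨h, hz', hw'⟩
  · exact (hw (by rw [Set.mem_ofPred_eq, ← h]; exact hz)).elim
  · obtain ⟨h1, h2⟩ := SimpleGraph.eq_of_adj_of_reachable_deleteEdges _ _ h hz hw
    rw [h1, h2, ← hx] at hz'
    rw [h1, h2, ← hy] at hw'
    exact ⟨Subtype.ext (Prod.ext h1 hz'), Subtype.ext (Prod.ext h2 hw')⟩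

lemma starGraph_isTree : (D.starGraph M).IsTree := by
  refine SimpleGraph.isTree_of_forall_exists_cut (D.starGraph_connected M) fun x y h => ?_
  rcases D.starGraph_adj_cases M h with ⟨t, A, hA, rfl, rfl⟩ | ⟨t, A, hA, rfl, rfl⟩ | ⟨h, hx, hy⟩
  · exact ⟨D.leafCut M t A, D.starLeaf_mem_leafCut M hA, D.starCenter_not_mem_leafCut M t A,
      D.leafCut_cut M hA⟩
  · exact ⟨(D.leafCut M t A)ᶜ, D.starCenter_not_mem_leafCut M t A,
      not_not.2 (D.starLeaf_mem_leafCut M hA), fun x y hxy hx hy =>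
      (D.leafCut_cut M hA y x hxy.symm (not_not.1 hy) hx).symm⟩
  · exact ⟨_, .rfl, D.isTree.not_reachable_deleteEdges h, D.edgeCut_cut M hx hy⟩

variable {M}

lemma mem_part_iff_exists_starPart {v : V} {t : T} :
    v ∈ D.part t ↔ ∃ x : StarNode M, x.1.1 = t ∧ v ∈ D.starPart M x := by
  constructor
  · intro hv
    by_cases h : ∀ A ∈ M t, v ∈ A.right
    · exact ⟨starCenter M t, rfl, hv, Set.mem_iInter₂.2 h⟩
    · push Not at h
      obtain ⟨A, hA, hvA⟩ := h
      exact ⟨starLeaf M hA, rfl, hv, (A.mem_left_or_mem_right v).resolve_right hvA⟩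
  · rintro ⟨x, rfl, hx⟩
    exact hx.1

variable {D} (hM : D.IsStarSystem M)

namespace IsStarSystem

include hM

/-- Two star elements above the same edge separation would put side s t inside side t s. So the
choice in `attach` is forced, which canonicity requires. -/
lemma attach_eq_some_iff {s t : T} (h : D.tree.Adj t s) {A : GraphSep G} :
    D.attach M t s = some A ↔ A ∈ M t ∧ D.EdgeLE s t A := by
  refine ⟨fun h => D.mem_of_mem_attach M h, fun hA => ?_⟩
  cases hC : D.attach M t s with
  | none =>
    unfold attach at hC
    rw [dif_pos ⟨A, hA⟩] at hC
    simp at hC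
  | some C =>
    have hC := D.mem_of_mem_attach M hC
    by_contra hne
    have hle := hM.le_inv t C hC.1 A hA.1 fun h => hne (by rw [h])
    exact hM.not_subset s t h.symm (hC.2.1.trans (hle.1.trans hA.2.2))

lemma edgeLE_inv {s t : T} (h : D.tree.Adj t s) {A : GraphSep G} (hA : A ∈ M t)
    (hn : D.attach M t s ≠ some A) : D.EdgeLE s t A.inv :=
  (hM.edgeLE_or t A hA s h).resolve_left fun h' =>
    hn ((hM.attach_eq_some_iff h).2 ⟨hA, h'⟩)

/-- If the branch at s is not attached to the leaf, its edge separation lies below A.inv, so A.left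
stays on t's side of that edge. Hence vertices of A.left outside the part of t occur behind the
leaf. -/
lemma exists_mem_leafCut_iff {t : T} {A : GraphSep G} (hA : A ∈ M t) (v : V) :
    (∃ x ∈ D.leafCut M t A, v ∈ D.starPart M x) ↔ v ∈ A.left := by
  constructor
  · rintro ⟨⟨⟨u, a⟩, ha⟩, ⟨rfl, rfl⟩ | ⟨s, hs, hsA, hr⟩, hv⟩
    · exact hv.2
    · exact (D.mem_of_mem_attach M hsA).2.1 ⟨u, hr, hv.1⟩
  · intro hv
    by_cases hvt : v ∈ D.part t
    · exact ⟨starLeaf M hA, D.starLeaf_mem_leafCut M hA, hvt, hv⟩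
    · obtain ⟨s, hs, ⟨u, hr, hvu⟩, hn⟩ := D.exists_mem_side_of_not_mem_part hvt
      obtain ⟨x, rfl, hx⟩ := (D.mem_part_iff_exists_starPart (M := M)).1 hvu
      refine ⟨x, Or.inr ⟨s, hs, ?_, hr⟩, hx⟩
      by_contra h
      exact hn ((hM.edgeLE_inv hs hA h).2 hv)

lemma exists_not_mem_leafCut_iff {t : T} {A : GraphSep G} (hA : A ∈ M t) (v : V) :
    (∃ x ∉ D.leafCut M t A, v ∈ D.starPart M x) ↔ v ∈ A.right := by
  constructor
  · rintro ⟨⟨⟨u, a⟩, ha⟩, hx, hv⟩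
    by_cases hu : u = t
    · subst hu
      cases a with
      | none => exact Set.mem_iInter₂.1 hv.2 A hA
      | some C => exact (hM.le_inv u C (ha C rfl) A hA fun h => hx (Or.inl ⟨rfl, congrArg some h⟩)).1 hv.2
    · obtain ⟨s, hs, hr⟩ := SimpleGraph.exists_adj_reachable_deleteEdges
        D.isTree.connected.preconnected hu
      exact (hM.edgeLE_inv hs hA fun h => hx (Or.inr ⟨s, hs, h, hr⟩)).1 ⟨u, hr, hv.1⟩
  · intro hv
    by_cases hvt : v ∈ D.part t
    · by_cases h : ∀ C ∈ M t, v ∈ C.right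
      · exact ⟨starCenter M t, D.starCenter_not_mem_leafCut M t A, hvt, Set.mem_iInter₂.2 h⟩
      · push Not at h
        obtain ⟨C, hC, hvC⟩ := h
        refine ⟨starLeaf M hC, ?_, hvt, (C.mem_left_or_mem_right v).resolve_right hvC⟩
        rintro (⟨-, h⟩ | ⟨s, hs, -, h⟩)
        · exact hvC (Option.some.inj h ▸ hv)
        · exact D.isTree.not_reachable_deleteEdges hs.symm h
    · obtain ⟨s, hs, ⟨u, hr, hvu⟩, hn⟩ := D.exists_mem_side_of_not_mem_part hvt
      obtain ⟨x, rfl, hx⟩ := (D.mem_part_iff_exists_starPart (M := M)).1 hvu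
      refine ⟨x, ?_, hx⟩
      rintro (⟨h, -⟩ | ⟨s', hs', hA', hr'⟩)
      · exact hvt (h ▸ hvu)
      · have hv' := (D.mem_of_mem_attach M hA').2.2 hv
        have : v ∈ D.part t := D.side_inter_subset hs' ⟨hv', _, hr', hvu⟩
        exact hvt this

/-- At every edge at t, one of the two sides of A lies entirely on t's side, and so does the
separator. -/
lemma left_inter_right_subset {t : T} {A : GraphSep G} (hA : A ∈ M t) :
    A.left ∩ A.right ⊆ D.part t := by
  intro v hv
  by_contra hvt
  obtain ⟨s, hs, -, hn⟩ := D.exists_mem_side_of_not_mem_part hvt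
  rcases hM.edgeLE_or t A hA s hs with h | h
  · exact hn (h.2 hv.2)
  · exact hn (h.2 hv.1)

-- Old tree-edges keep their separations, since the nodes of each star together cover the old part.
omit hM in
lemma exists_reachable_iff {x y : StarNode M} (hxy : D.tree.Adj x.1.1 y.1.1)
    (hx : x.1.2 = D.attach M x.1.1 y.1.1) (hy : y.1.2 = D.attach M y.1.1 x.1.1) (v : V) :
    (∃ u, ((D.starGraph M).deleteEdges {s(x, y)}).Reachable x u ∧ v ∈ D.starPart M u) ↔
      v ∈ D.side x.1.1 y.1.1 := by
  simp only [SimpleGraph.reachable_deleteEdges_iff (D.starGraph_connected M).preconnected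
    (U := {z : StarNode M | (D.tree.deleteEdges {s(x.1.1, y.1.1)}).Reachable x.1.1 z.1.1}) .rfl
    (D.isTree.not_reachable_deleteEdges hxy) (D.edgeCut_cut M hx hy)]
  constructor
  · rintro ⟨u, hu, hv⟩
    exact ⟨_, hu, hv.1⟩
  · rintro ⟨u, hu, hv⟩
    obtain ⟨z, rfl, hz⟩ := (D.mem_part_iff_exists_starPart (M := M)).1 hv
    exact ⟨z, hu, hz⟩

lemma exists_reachable_leaf_iff {t : T} {A : GraphSep G} (hA : A ∈ M t) (v : V) :
    (∃ u, ((D.starGraph M).deleteEdges {s(starLeaf M hA, starCenter M t)}).Reachable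
      (starLeaf M hA) u ∧ v ∈ D.starPart M u) ↔ v ∈ A.left := by
  simp only [SimpleGraph.reachable_deleteEdges_iff (D.starGraph_connected M).preconnected
    (D.starLeaf_mem_leafCut M hA) (D.starCenter_not_mem_leafCut M t A) (D.leafCut_cut M hA)]
  exact hM.exists_mem_leafCut_iff hA v

lemma exists_reachable_center_iff {t : T} {A : GraphSep G} (hA : A ∈ M t) (v : V) :
    (∃ u, ((D.starGraph M).deleteEdges {s(starCenter M t, starLeaf M hA)}).Reachable
      (starCenter M t) u ∧ v ∈ D.starPart M u) ↔ v ∈ A.right := by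
  simp only [SimpleGraph.reachable_deleteEdges_iff_not_mem (D.starGraph_connected M).preconnected
    (D.starLeaf_mem_leafCut M hA) (D.starCenter_not_mem_leafCut M t A) (D.leafCut_cut M hA)]
  exact hM.exists_not_mem_leafCut_iff hA v

lemma left_inter_right_subset_starPart {t : T} {A : GraphSep G} (hA : A ∈ M t) :
    A.left ∩ A.right ⊆ D.starPart M (starCenter M t) := fun v hv =>
  ⟨hM.left_inter_right_subset hA hv, Set.mem_iInter₂.2 fun C hC => by
    by_cases h : A = C
    · exact h ▸ hv.2
    · exact (hM.le_inv t A hA C hC h).1 hv.1⟩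

omit hM in
/-- The refinement of a tree-decomposition by a system of stars. -/
def refine (hM : D.IsStarSystem M) : TreeDecomp G (StarNode M) :=
  .ofSides (D.starGraph M) (D.starGraph_isTree M) (D.starPart M)
    (fun v => by
      obtain ⟨t, ht⟩ := D.vertex_mem v
      obtain ⟨x, -, hx⟩ := (D.mem_part_iff_exists_starPart (M := M)).1 ht
      exact ⟨x, hx⟩)
    (fun u v huv => by
      obtain ⟨t, hu, hv⟩ := D.edge_mem u v huv
      by_cases h : ∀ A ∈ M t, u ∈ A.right ∧ v ∈ A.right
      · exact ⟨starCenter M t, ⟨hu, Set.mem_iInter₂.2 fun A hA => (h A hA).1⟩,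
          hv, Set.mem_iInter₂.2 fun A hA => (h A hA).2⟩
      · push Not at h
        obtain ⟨A, hA, h⟩ := h
        have h1 := A.mem_left_or_mem_right u
        have h2 := A.mem_left_or_mem_right v
        refine ⟨starLeaf M hA, ⟨hu, ?_⟩, hv, ?_⟩
        · by_contra hn
          change u ∉ A.left at hn
          have hur := h1.resolve_left hn
          exact A.not_adj v ⟨h2.resolve_right (h hur), h hur⟩ u ⟨hur, hn⟩ huv.symm
        · by_contra hn
          change v ∉ A.left at hn
          have hvr := h2.resolve_left hn
          have hul : u ∉ A.right := fun h' => h h' hvr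
          exact A.not_adj u ⟨h1.resolve_right hul, hul⟩ v ⟨hvr, hn⟩ huv)
    (by
      intro x y hxy v hv hv'
      rw [Sym2.eq_swap] at hv'
      rcases D.starGraph_adj_cases M hxy with
        ⟨t, A, hA, rfl, rfl⟩ | ⟨t, A, hA, rfl, rfl⟩ | ⟨h, hx, hy⟩
      · rw [hM.exists_reachable_leaf_iff] at hv
        rw [hM.exists_reachable_center_iff] at hv'
        exact ⟨hM.left_inter_right_subset hA ⟨hv, hv'⟩, hv⟩
      · rw [hM.exists_reachable_center_iff] at hv
        rw [hM.exists_reachable_leaf_iff] at hv'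
        exact hM.left_inter_right_subset_starPart hA ⟨hv', hv⟩
      · rw [exists_reachable_iff h hx hy] at hv
        rw [exists_reachable_iff h.symm hy hx] at hv'
        refine ⟨D.side_inter_subset h ⟨hv, hv'⟩, ?_⟩
        -- The vertices beyond an old edge lie in A.right for every A in the star if the edge is
        -- attached to the centre, and in A.left if it is attached to the leaf of A.
        cases ha : D.attach M x.1.1 y.1.1 with
        | none =>
          rw [hx, ha]
          exact Set.mem_iInter₂.2 fun A hA => (hM.edgeLE_inv h hA (by simp [ha])).1 hv'
        | some A =>
          rw [hx, ha]
          exact (D.mem_of_mem_attach M ha).2.1 hv')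

lemma refine_edgesIn {S : Set (GraphSep G)} (hS : ∀ A ∈ S, A.inv ∈ S) (hMS : ∀ t, M t ⊆ S)
    (hD : D.EdgesIn S) : hM.refine.EdgesIn S := by
  intro x y hxy
  rcases D.starGraph_adj_cases M hxy with
    ⟨t, A, hA, rfl, rfl⟩ | ⟨t, A, hA, rfl, rfl⟩ | ⟨h, hx, hy⟩
  · exact ⟨A, hMS t hA, Set.ext fun v => (hM.exists_reachable_leaf_iff hA v).symm,
      Set.ext fun v => (hM.exists_reachable_center_iff hA v).symm⟩
  · exact ⟨A.inv, hS A (hMS t hA), Set.ext fun v => (hM.exists_reachable_center_iff hA v).symm,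
      Set.ext fun v => (hM.exists_reachable_leaf_iff hA v).symm⟩
  · obtain ⟨A, hA, h1, h2⟩ := hD _ _ h
    exact ⟨A, hA, h1.trans (Set.ext fun v => (exists_reachable_iff h hx hy v).symm),
      h2.trans (Set.ext fun v => (exists_reachable_iff h.symm hy hx v).symm)⟩

lemma refine_refines : hM.refine.Refines D := by
  refine ⟨fun x => x.1.1, fun t => ?_, fun s t => ?_, fun t => ?_⟩
  · have hc : ∀ x : (fun x : StarNode M => x.1.1) ⁻¹' {t},
        (hM.refine.tree.induce ((fun x : StarNode M => x.1.1) ⁻¹' {t})).Reachable x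
          ⟨starCenter M t, rfl⟩ := by
      rintro ⟨⟨⟨u, _ | A⟩, ha⟩, hu⟩
      · obtain rfl : u = t := hu
        exact .rfl
      · obtain rfl : u = t := hu
        exact SimpleGraph.Adj.reachable (D.starGraph_adj_leaf_center M (ha A rfl))
    exact { preconnected := fun x y => (hc x).trans (hc y).symm
            nonempty := ⟨⟨starCenter M t, rfl⟩⟩ }
  · constructor
    · intro h
      exact ⟨h.ne, _, _, rfl, rfl, D.starGraph_adj_attachNode M h⟩
    · rintro ⟨hne, x, y, rfl, rfl, h | h⟩
      · exact (hne h.1).elim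
      · exact h.1
  · ext v
    rw [D.mem_part_iff_exists_starPart (M := M)]
    simp only [Set.mem_iUnion, Set.mem_preimage, Set.mem_singleton_iff, exists_prop]
    exact Iff.rfl

end IsStarSystem

/-! ### Automorphisms act on the refined tree -/

section Canonical

variable {φ : G ≃g G} {π : D.tree ≃g D.tree}

omit hM in
lemma part_symm (h : ∀ t, D.part (π t) = φ '' D.part t) (t : T) :
    D.part (π.symm t) = φ.symm '' D.part t := by
  conv_rhs => rw [← π.apply_symm_apply t, h]
  ext v
  simp [Set.mem_image]

omit hM in
lemma image_side_subset (h : ∀ t, D.part (π t) = φ '' D.part t) (s t : T) :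
    φ '' D.side s t ⊆ D.side (π s) (π t) := by
  rintro _ ⟨v, ⟨u, hu, hv⟩, rfl⟩
  refine ⟨π u, ?_, h u ▸ ⟨v, hv, rfl⟩⟩
  exact SimpleGraph.reachable_deleteEdges_map π hu

omit hM in
lemma side_map (h : ∀ t, D.part (π t) = φ '' D.part t) (s t : T) :
    D.side (π s) (π t) = φ '' D.side s t := by
  refine Set.Subset.antisymm (fun v hv => ?_) (image_side_subset h s t)
  have := image_side_subset (part_symm h) (π s) (π t) ⟨v, hv, rfl⟩
  rw [π.symm_apply_apply, π.symm_apply_apply] at this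
  exact ⟨_, this, φ.apply_symm_apply v⟩

omit hM in
lemma EdgeLE.map (h : ∀ t, D.part (π t) = φ '' D.part t) {s t : T} {A : GraphSep G}
    (hA : D.EdgeLE s t A) : D.EdgeLE (π s) (π t) (A.map φ) := by
  unfold EdgeLE
  rw [side_map h, side_map h]
  exact ⟨Set.image_mono hA.1, Set.image_mono hA.2⟩

namespace IsStarSystem

/-- Uniqueness of the attaching leaf carries it along φ; applying the inverse automorphism shows
that attachment to a centre is preserved too. -/
lemma attach_map (hM : D.IsStarSystem M) (h : ∀ t, D.part (π t) = φ '' D.part t)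
    (hφ : ∀ t, ∀ A ∈ M t, A.map φ ∈ M (π t))
    (hφ' : ∀ t, ∀ A ∈ M t, A.map φ.symm ∈ M (π.symm t)) {s t : T} (hst : D.tree.Adj t s) :
    D.attach M (π t) (π s) = (D.attach M t s).map (GraphSep.map φ) := by
  cases ha : D.attach M t s with
  | some A =>
    have hA := D.mem_of_mem_attach M ha
    exact (hM.attach_eq_some_iff (π.map_adj_iff.2 hst)).2 ⟨hφ t A hA.1, hA.2.map h⟩
  | none =>
    by_contra hne
    obtain ⟨C, hC⟩ := Option.ne_none_iff_exists'.1 hne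
    have hC := D.mem_of_mem_attach M hC
    have h1 := hφ' _ C hC.1
    have h2 := hC.2.map (part_symm h)
    rw [π.symm_apply_apply] at h1 h2
    rw [π.symm_apply_apply] at h2
    rw [(hM.attach_eq_some_iff hst).2 ⟨h1, h2⟩] at ha
    simp at ha

lemma refine_isCanonical (hM : D.IsStarSystem M) {S : Set (GraphSep G)} (hD : D.IsCanonical S)
    (hMS : ∀ φ : G ≃g G, GraphSep.map φ '' S = S → ∀ π : D.tree ≃g D.tree,
      (∀ t, D.part (π t) = φ '' D.part t) → ∀ t, ∀ A ∈ M t, A.map φ ∈ M (π t)) :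
    hM.refine.IsCanonical S := by
  intro φ hφS
  obtain ⟨π, h⟩ := hD φ hφS
  have hφS' := image_map_symm_eq φ hφS
  have hφ := hMS φ hφS π h
  have hφ' := hMS φ.symm hφS' π.symm (part_symm h)
  let f : StarNode M ≃ StarNode M :=
    { toFun := fun x => ⟨(π x.1.1, x.1.2.map (GraphSep.map φ)), fun A hA => by
        obtain ⟨C, hC, rfl⟩ := Option.mem_map.1 hA
        exact hφ _ C (x.2 C hC)⟩
      invFun := fun x => ⟨(π.symm x.1.1, x.1.2.map (GraphSep.map φ.symm)), fun A hA => by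
        obtain ⟨C, hC, rfl⟩ := Option.mem_map.1 hA
        exact hφ' _ C (x.2 C hC)⟩
      left_inv := fun x => Subtype.ext (Prod.ext (π.symm_apply_apply _) (by
        change (x.1.2.map _).map _ = _
        rw [Option.map_map, show GraphSep.map φ.symm ∘ GraphSep.map φ = id from
          funext (map_symm_map φ), Option.map_id, id]))
      right_inv := fun x => Subtype.ext (Prod.ext (π.apply_symm_apply _) (by
        change (x.1.2.map _).map _ = _
        rw [Option.map_map, show GraphSep.map φ ∘ GraphSep.map φ.symm = id from
          funext (map_map_symm φ), Option.map_id, id])) }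
  refine ⟨⟨f, ?_⟩, ?_⟩
  · intro x y
    change ((π x.1.1 = π y.1.1 ∧ (x.1.2.map _ = none ∧ y.1.2.map _ ≠ none ∨
      x.1.2.map _ ≠ none ∧ y.1.2.map _ = none)) ∨ (D.tree.Adj (π x.1.1) (π y.1.1) ∧
      x.1.2.map _ = D.attach M (π x.1.1) (π y.1.1) ∧
      y.1.2.map _ = D.attach M (π y.1.1) (π x.1.1))) ↔ _
    have hinj := Option.map_injective (map_injective φ)
    simp only [Option.map_eq_none_iff, ne_eq, π.map_adj_iff, π.injective.eq_iff]
    refine or_congr Iff.rfl (and_congr_right fun hxy => ?_)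
    rw [hM.attach_map h hφ hφ' hxy, hM.attach_map h hφ hφ' hxy.symm, hinj.eq_iff, hinj.eq_iff]
  · intro x
    change D.part (π x.1.1) ∩ (x.1.2.map _).elim _ _ = φ '' (D.part x.1.1 ∩ x.1.2.elim _ _)
    rw [Set.image_inter φ.injective, h]
    congr 1
    obtain ⟨⟨t, _ | A⟩, ha⟩ := x
    · change ⋂ A ∈ M (π t), A.right = φ '' ⋂ A ∈ M t, A.right
      simp only [Set.image_iInter φ.bijective]
      ext v
      simp only [Set.mem_iInter]
      constructor
      · exact fun hv A hA => hv _ (hφ t A hA)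
      · intro hv A hA
        have := hv (A.map φ.symm) (by simpa using hφ' _ A hA)
        rwa [← map_right, map_map_symm] at this
    · rfl

end IsStarSystem

end Canonical

end TreeDecomp

namespace TreeDecomp

open GraphSep

/-! ### Renaming the nodes of the tree -/

section Transport

variable {V : Type*} {G : SimpleGraph V} {T T' : Type*} (D : TreeDecomp G T) (e : T' ≃ T)

/-- The tree-decomposition obtained by renaming the nodes of the tree. -/
def transport : TreeDecomp G T' where
  tree := D.tree.comap e
  isTree := (SimpleGraph.Iso.comap e D.tree).isTree_iff.2 D.isTree
  part t := D.part (e t)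
  vertex_mem v := (D.vertex_mem v).imp' e.symm fun t h => by rwa [e.apply_symm_apply]
  edge_mem u v h := (D.edge_mem u v h).imp' e.symm fun t h => by rwa [e.apply_symm_apply]
  inter_subset r t p hp s hs :=
    D.inter_subset (e r) (e t) (p.map (SimpleGraph.Iso.comap e D.tree).toHom)
      (SimpleGraph.Walk.IsPath.map e.injective hp) (e s)
      ((congrArg (e s ∈ ·) (SimpleGraph.Walk.support_map
        (SimpleGraph.Iso.comap e D.tree).toHom p)).mpr (List.mem_map_of_mem hs))

lemma side_transport (s t : T') : (D.transport e).side s t = D.side (e s) (e t) := by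
  ext v
  constructor
  · rintro ⟨u, hu, hv⟩
    exact ⟨e u, SimpleGraph.reachable_deleteEdges_map (SimpleGraph.Iso.comap e D.tree) hu, hv⟩
  · rintro ⟨u, hu, hv⟩
    have := SimpleGraph.reachable_deleteEdges_map (SimpleGraph.Iso.comap e D.tree).symm hu
    refine ⟨e.symm u, ?_, by change v ∈ D.part (e (e.symm u)); rwa [e.apply_symm_apply]⟩
    change (SimpleGraph.deleteEdges _ {s(e.symm (e s), e.symm (e t))}).Reachable
      (e.symm (e s)) (e.symm u) at this
    rwa [e.symm_apply_apply, e.symm_apply_apply] at this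

variable {D}

lemma EdgesIn.transport {S : Set (GraphSep G)} (h : D.EdgesIn S) :
    (D.transport e).EdgesIn S := fun s t hst => by
  rw [side_transport, side_transport]
  exact h (e s) (e t) hst

lemma IsCanonical.transport {S : Set (GraphSep G)} (h : D.IsCanonical S) :
    (D.transport e).IsCanonical S := fun φ hφ => by
  obtain ⟨π, hπ⟩ := h φ hφ
  let i := SimpleGraph.Iso.comap e D.tree
  refine ⟨(i.trans π).trans i.symm, fun t => ?_⟩
  change D.part (e (e.symm (π (e t)))) = _
  rw [e.apply_symm_apply, hπ]
  rfl

lemma SeparatesBlocks.transport {k : ℕ} (h : D.SeparatesBlocks k) :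
    (D.transport e).SeparatesBlocks k := by
  refine ⟨fun X hX => ?_, fun X Y hX hY hXY s t => h.2 X Y hX hY hXY (e s) (e t)⟩
  obtain ⟨t, ht⟩ := h.1 X hX
  exact ⟨e.symm t, by change X ⊆ D.part (e (e.symm t)); rwa [e.apply_symm_apply]⟩

lemma WellSeparatedBlocksAreParts.transport {k : ℕ} {S : Set (GraphSep G)}
    (h : D.WellSeparatedBlocksAreParts k S) :
    (D.transport e).WellSeparatedBlocksAreParts k S :=
  fun X hX hXS t => h X hX hXS (e t)

lemma Refines.transport {T₀ : Type*} {D₀ : TreeDecomp G T₀} (h : D.Refines D₀) :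
    (D.transport e).Refines D₀ := by
  obtain ⟨f, h1, h2, h3⟩ := h
  refine ⟨f ∘ e, fun t => ?_, fun s t => ?_, fun t => ?_⟩
  · let i : (D.transport e).tree.induce (f ∘ e ⁻¹' {t}) ≃g D.tree.induce (f ⁻¹' {t}) :=
      { toFun := fun x => ⟨e x.1, x.2⟩
        invFun := fun x => ⟨e.symm x.1, by
          change f (e (e.symm x.1)) = t
          rw [e.apply_symm_apply]
          exact x.2⟩
        left_inv := fun x => Subtype.ext (e.symm_apply_apply _)
        right_inv := fun x => Subtype.ext (e.apply_symm_apply _)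
        map_rel_iff' := Iff.rfl }
    exact i.connected_iff.2 (h1 t)
  · rw [h2]
    refine and_congr_right fun _ => ⟨?_, ?_⟩
    · rintro ⟨x, y, hx, hy, hxy⟩
      refine ⟨e.symm x, e.symm y, by simpa, by simpa, ?_⟩
      change D.tree.Adj (e (e.symm x)) (e (e.symm y))
      rwa [e.apply_symm_apply, e.apply_symm_apply]
    · rintro ⟨x, y, hx, hy, hxy⟩
      exact ⟨e x, e y, hx, hy, hxy⟩
  · rw [h3]
    ext v
    simp only [Set.mem_iUnion, Set.mem_preimage, Set.mem_singleton_iff, exists_prop,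
      Function.comp_apply]
    exact (e.exists_congr_left (p := fun x => f (e x) = t ∧ v ∈ (D.transport e).part x)).trans
      (by simp [TreeDecomp.transport]) |>.symm

end Transport

/-! ### Stars at well separated blocks, and leaf parts -/

variable {V : Type*} {G : SimpleGraph V} {k : ℕ} {S : Set (GraphSep G)} {T : Type*}
  {D : TreeDecomp G T}

/-- The maximal separations in `S` pointing to the well separated blocks in the part of `t`. -/
def blockStar (D : TreeDecomp G T) (k : ℕ) (S : Set (GraphSep G)) (t : T) : Set (GraphSep G) :=
  {A | ∃ X, IsKBlock G k X ∧ WellSeparatedIn S (blockProfile G k X) ∧ X ⊆ D.part t ∧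
    Maximal (· ∈ blockProfile G k X ∩ S) A}

lemma SeparatesBlocks.eq_of_subset_part (h : D.SeparatesBlocks k) {X Y : Set V}
    (hX : IsKBlock G k X) (hY : IsKBlock G k Y) {t : T} (hXt : X ⊆ D.part t)
    (hYt : Y ⊆ D.part t) : X = Y :=
  by_contra fun hne => h.2 X Y hX hY hne t t hXt hYt rfl

lemma image_symm_image (φ : G ≃g G) (X : Set V) : φ '' (φ.symm '' X) = X := by
  ext v; simp [Set.mem_image]

lemma map_mem_blockProfile (φ : G ≃g G) {X : Set V} {A : GraphSep G}
    (hA : A ∈ blockProfile G k X) : A.map φ ∈ blockProfile G k (φ '' X) :=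
  ⟨hA.1.map φ, by rw [order_map]; exact hA.2.1, Set.image_mono hA.2.2⟩

lemma SeparatesBlocks.subset_right_of_mem_blockStar (h : D.SeparatesBlocks k) {X : Set V}
    (hX : IsKBlock G k X) {t : T} (hXt : X ⊆ D.part t) {A : GraphSep G}
    (hA : A ∈ D.blockStar k S t) : A ∈ blockProfile G k X := by
  obtain ⟨Y, hY, -, hYt, hA⟩ := hA
  rw [h.eq_of_subset_part hX hY hXt hYt]
  exact hA.prop.1

lemma map_maximal_blockProfile (φ : G ≃g G) (hφ : GraphSep.map φ '' S = S) {X : Set V}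
    {A : GraphSep G} (hA : Maximal (· ∈ blockProfile G k X ∩ S) A) :
    Maximal (· ∈ blockProfile G k (φ '' X) ∩ S) (A.map φ) := by
  refine ⟨⟨map_mem_blockProfile φ hA.prop.1, hφ ▸ ⟨A, hA.prop.2, rfl⟩⟩, fun C hC hle => ?_⟩
  obtain ⟨E, hE, rfl⟩ : C ∈ GraphSep.map φ '' S := hφ.symm ▸ hC.2
  rw [map_le_map_iff] at hle ⊢
  exact hA.le_of_ge ⟨⟨(by
    simpa only [map_symm_map] using hC.1.1.map φ.symm), by simpa only [order_map] using hC.1.2.1,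
    (Set.image_subset_image_iff φ.injective).1 hC.1.2.2⟩, hE⟩ hle

lemma map_mem_blockStar (φ : G ≃g G) (hφ : GraphSep.map φ '' S = S) (π : D.tree ≃g D.tree)
    (h : ∀ t, D.part (π t) = φ '' D.part t) (t : T) (A : GraphSep G)
    (hA : A ∈ D.blockStar k S t) : A.map φ ∈ D.blockStar k S (π t) := by
  obtain ⟨X, hX, hXS, hXt, hA⟩ := hA
  refine ⟨φ '' X, hX.image φ, fun C E hC hE => ?_, h t ▸ Set.image_mono hXt,
    map_maximal_blockProfile φ hφ hA⟩
  have h1 := map_maximal_blockProfile φ.symm (image_map_symm_eq φ hφ) hC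
  have h2 := map_maximal_blockProfile φ.symm (image_map_symm_eq φ hφ) hE
  rw [show φ.symm '' (φ '' X) = X from image_symm_image φ.symm X] at h1 h2
  exact (map_nested_iff φ.symm).1 (hXS _ _ h1 h2)

lemma refine_separatesBlocks (hM : D.IsStarSystem (D.blockStar k S)) (h : D.SeparatesBlocks k) :
    hM.refine.SeparatesBlocks k := by
  refine ⟨fun X hX => ?_, fun X Y hX hY hXY s t hs ht hst => ?_⟩
  · obtain ⟨t, ht⟩ := h.1 X hX
    exact ⟨starCenter _ t, Set.subset_inter ht (Set.subset_iInter₂ fun A hA =>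
      (h.subset_right_of_mem_blockStar hX ht hA).2.2)⟩
  · exact hXY (h.eq_of_subset_part hX hY (hs.trans Set.inter_subset_left)
      ((hst ▸ ht).trans Set.inter_subset_left))

variable [Finite V]

/-- All elements of one star come from the same block X, the only one in the part. Distinct nested
maximal elements can only point away from each other, as X lies on the right of both. The separation
of an edge towards t also has X on its right, so it lies below some maximal element: below A itself,
or below another one and hence below A.inv. -/
lemma isStarSystem_blockStar (hS : ∀ A ∈ S, A.IsProper ∧ A.order < k) (hD : D.EdgesIn S)
    (h : D.SeparatesBlocks k) : D.IsStarSystem (D.blockStar k S) := by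
  have hle : ∀ X, IsKBlock G k X → WellSeparatedIn S (blockProfile G k X) → ∀ A C,
      Maximal (· ∈ blockProfile G k X ∩ S) A → Maximal (· ∈ blockProfile G k X ∩ S) C → A ≠ C →
      A ≤ C.inv := by
    intro X hX hXS A C hA hC hne
    rcases hXS A C hA hC with h' | h' | h' | h'
    · exact (hne (hA.eq_of_le hC.prop h')).elim
    · exact (hne (hC.eq_of_le hA.prop h').symm).elim
    · exact h'
    · exact (hX.not_subset_right hA.prop.1.2.1 (hC.prop.1.2.2.trans h'.1) hA.prop.1.2.2).elim
  refine ⟨?_, ?_, ?_⟩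
  · rintro t A ⟨X, hX, hXS, hXt, hA⟩ C ⟨Y, hY, -, hYt, hC⟩ hne
    obtain rfl := h.eq_of_subset_part hX hY hXt hYt
    exact hle X hX hXS A C hA hC hne
  · rintro t A ⟨X, hX, hXS, hXt, hA⟩ s hst
    obtain ⟨E, hE, hE1, hE2⟩ := hD s t hst.symm
    have hEX : E ∈ blockProfile G k X ∩ S :=
      ⟨⟨(hS E hE).1, (hS E hE).2, hE2 ▸ hXt.trans (D.part_subset_side t s)⟩, hE⟩
    obtain ⟨B, hEB, hB⟩ := Set.Finite.exists_le_maximal (Set.toFinite _) hEX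
    unfold EdgeLE
    rw [← hE1, ← hE2]
    by_cases hBA : B = A
    · exact Or.inl (hBA ▸ hEB)
    · exact Or.inr (hEB.trans (hle X hX hXS B A hB hA hBA))
  · intro s t hst hss
    obtain ⟨E, hE, hE1, hE2⟩ := hD s t hst
    exact (hS E hE).1.1 (by rwa [hE1, hE2])

/-- At the centre, a vertex outside X is removed by a maximal separation above a tight one that
excludes it. A leaf part cannot contain X, which would then lie in the separator of A. -/
lemma refine_wellSeparatedBlocksAreParts
    (hS : ∀ A : GraphSep G, A.IsProper → A.order < k → A.IsTight → A ∈ S)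
    (hM : D.IsStarSystem (D.blockStar k S)) (h : D.SeparatesBlocks k) :
    hM.refine.WellSeparatedBlocksAreParts k S := by
  rintro X hX hXS ⟨⟨t, _ | A⟩, ha⟩ hXt
  · have hXt' : X ⊆ D.part t := hXt.trans Set.inter_subset_left
    refine Set.Subset.antisymm (fun v hv => ?_) hXt
    by_contra hvX
    obtain ⟨A, hAt, hA, hvA⟩ := hX.exists_tight_not_mem hvX
    obtain ⟨B, hAB, hB⟩ := Set.Finite.exists_le_maximal
      (s := blockProfile G k X ∩ S) (Set.toFinite _) ⟨hA, hS A hA.1 hA.2.1 hAt⟩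
    exact hvA (hAB.2 (Set.mem_iInter₂.1 hv.2 B ⟨X, hX, hXS, hXt', hB⟩))
  · have hA := h.subset_right_of_mem_blockStar hX (hXt.trans Set.inter_subset_left) (ha A rfl)
    exact (hX.not_subset_right hA.2.1 (hXt.trans Set.inter_subset_right) hA.2.2).elim

/-- For reduced feasible tasks, a block in a leaf part is well separated. -/
lemma leavesAreBlocks (hS : ∀ A ∈ S, A.IsProper ∧ A.order < k) (hsymm : ∀ A ∈ S, A.inv ∈ S)
    (hD : D.EdgesIn S) (h : D.SeparatesBlocks k) (hW : D.WellSeparatedBlocksAreParts k S)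
    (hred : IsReducedTask S (blockProfiles G k)) (hfeas : IsFeasibleTask S (blockProfiles G k)) :
    D.LeavesAreBlocks k := by
  intro t ht
  obtain ⟨s, hs⟩ := Set.ncard_eq_one.1 ht
  have hst : D.tree.Adj t s := by
    have : s ∈ D.tree.neighborSet t := hs ▸ Set.mem_singleton s
    exact this
  have huniq : ∀ b, D.tree.Adj t b → b = s := fun b hb => by
    have : b ∈ D.tree.neighborSet t := hb
    rwa [hs] at this
  have hother : ∀ u, u ≠ t → D.part u ⊆ D.side s t := fun u hu => by
    obtain ⟨b, hb, hsub⟩ := D.part_subset_side_of_ne hu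
    exact huniq b hb ▸ hsub
  have hside : D.side t s ⊆ D.part t := by
    rintro v ⟨u, hu, hv⟩
    by_cases hut : u = t
    · exact hut ▸ hv
    · exact D.side_inter_subset hst ⟨⟨u, hu, hv⟩, hother u hut hv⟩
  obtain ⟨E, hE, hE1, hE2⟩ := hD s t hst.symm
  -- Reducedness puts a block on each side of every F in S; applied to the leaf edge E, it supplies
  -- a block in the leaf part.
  have hblocks : ∀ F ∈ S, (∃ X, IsKBlock G k X ∧ X ⊆ F.right) ∧
      ∃ X, IsKBlock G k X ∧ X ⊆ F.left := by
    intro F hF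
    obtain ⟨_, ⟨X, hX, rfl⟩, _, ⟨Y, hY, rfl⟩, ⟨h1, h2⟩ | ⟨h1, h2⟩⟩ := hred F hF
    · exact ⟨⟨X, hX, h1.2.2⟩, Y, hY, h2.2.2⟩
    · exact ⟨⟨Y, hY, h2.2.2⟩, X, hX, h1.2.2⟩
  have hmem : ∀ F ∈ S, ∀ X, X ⊆ F.right → F ∈ blockProfile G k X := fun F hF X hX =>
    ⟨(hS F hF).1, (hS F hF).2, hX⟩
  obtain ⟨⟨X, hX, hXE⟩, Y, hY, hYE⟩ := hblocks E hE
  have hXt : X ⊆ D.part t := (hE2 ▸ hXE).trans hside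
  have hleft : ∀ Z, IsKBlock G k Z → Z ≠ X → Z ⊆ E.left := by
    intro Z hZ hne
    obtain ⟨u, hu⟩ := h.1 Z hZ
    rw [hE1]
    refine hu.trans (hother u fun hut => hne ?_)
    exact h.eq_of_subset_part hZ hX (hut ▸ hu) hXt
  have hEX : E ∈ blockProfile G k X ∩ S := ⟨hmem E hE X hXE, hE⟩
  -- F.right contains a block and lies inside E.right, where X is the only block.
  have habove : ∀ F ∈ S, E ≤ F → F ∈ blockProfile G k X ∩ S := by
    intro F hF hle
    obtain ⟨⟨Z, hZ, hZF⟩, -⟩ := hblocks F hF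
    refine ⟨hmem F hF X ?_, hF⟩
    by_cases hne : Z = X
    · exact hne ▸ hZF
    · exact (hZ.not_subset_right (hS E hE).2 (hleft Z hZ hne) (hZF.trans hle.2)).elim
  -- If F crosses E, feasibility provides an element of S above their corner. It lies above E, hence
  -- in P_k(X), so by maximality it is F.
  have hmax : ∀ F, Maximal (· ∈ blockProfile G k X ∩ S) F → E ≤ F := by
    intro F hF
    obtain ⟨-, Z, hZ, hZF⟩ := hblocks F hF.prop.2
    have hZX : Z ≠ X := fun h' =>
      hX.not_subset_right hF.prop.1.2.1 (h' ▸ hZF) hF.prop.1.2.2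
    have hZE := hleft Z hZ hZX
    by_cases hn : E.Nested F
    · rcases hn with h' | h' | h' | h'
      · exact h'
      · exact (hF.eq_of_le hEX h').ge
      · exact (hZ.not_subset_right hF.prop.1.2.1 hZF (hZE.trans h'.1)).elim
      · exact (hX.not_subset_right (hS E hE).2 (hF.prop.1.2.2.trans h'.1) hXE).elim
    · obtain ⟨F', hF', hle⟩ := hfeas.2 E hE F hF.prop.2 hn _ ⟨X, hX, rfl⟩ _ ⟨Z, hZ, rfl⟩
        hEX.1 hF.prop.1 (hmem _ (hsymm E hE) Z hZE) (hmem _ (hsymm F hF.prop.2) Z hZF)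
      have hEF' := (le_corner_left E F).trans hle
      rw [hF.eq_of_le (habove F' hF' hEF') ((le_corner_right E F).trans hle)]
      exact hEF'
  -- All maximal elements lie above E, so Y in E.left is on the left of each. Thus P_k(X) and P_k(Y)
  -- orient any crossing two oppositely, and feasibility gives an element of P_k(X) ∩ S above both,
  -- to which both must be equal.
  have hXS : WellSeparatedIn S (blockProfile G k X) := by
    intro A C hA hC
    by_contra hn
    obtain ⟨F, hF, hle⟩ := hfeas.2 A hA.prop.2 C hC.prop.2 hn _ ⟨X, hX, rfl⟩ _ ⟨Y, hY, rfl⟩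
      hA.prop.1 hC.prop.1 (hmem _ (hsymm A hA.prop.2) Y (hYE.trans (hmax A hA).1))
      (hmem _ (hsymm C hC.prop.2) Y (hYE.trans (hmax C hC).1))
    have h1 := (le_corner_left A C).trans hle
    have h2 := (le_corner_right A C).trans hle
    have hFX := habove F hF ((hmax A hA).trans h1)
    rw [hA.eq_of_le hFX h1, hC.eq_of_le hFX h2] at hn
    exact hn (Nested.refl F)
  rw [hW X hX hXS t hXt]
  exact hX

lemma exists_refinement [Finite T] (hsymm : ∀ A ∈ S, A.inv ∈ S)
    (hS : ∀ A ∈ S, A.IsProper ∧ A.order < k)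
    (htight : ∀ A : GraphSep G, A.IsProper → A.order < k → A.IsTight → A ∈ S)
    (hcan : D.IsCanonical S) (hD : D.EdgesIn S) (h : D.SeparatesBlocks k) :
    ∃ (T' : Type) (_ : Finite T') (D' : TreeDecomp G T'),
      D'.Refines D ∧ D'.IsCanonical S ∧ D'.EdgesIn S ∧ D'.SeparatesBlocks k ∧
      D'.WellSeparatedBlocksAreParts k S ∧
      (IsReducedTask S (blockProfiles G k) → IsFeasibleTask S (blockProfiles G k) →
        D'.LeavesAreBlocks k) := by
  have hM := isStarSystem_blockStar hS hD h
  -- The star nodes live in a larger universe in general; numbering them moves the tree to `Fin n`.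
  obtain ⟨n, ⟨e⟩⟩ := Finite.exists_equiv_fin (StarNode (D.blockStar k S))
  have hedges := (hM.refine_edgesIn hsymm (fun t A hA => by
    obtain ⟨X, -, -, -, hA⟩ := hA
    exact hA.prop.2) hD).transport e.symm
  have hsep := (refine_separatesBlocks hM h).transport e.symm
  have hwell := (refine_wellSeparatedBlocksAreParts htight hM h).transport e.symm
  exact ⟨Fin n, inferInstance, hM.refine.transport e.symm, hM.refine_refines.transport e.symm,
    (hM.refine_isCanonical hcan map_mem_blockStar).transport e.symm, hedges, hsep, hwell,
    leavesAreBlocks hS hsymm hedges hsep hwell⟩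

end TreeDecomp

theorem theorem3p1 {V : Type*} [Finite V] (G : SimpleGraph V) (k : ℕ) (hk : 1 ≤ k)
    (S : Set (GraphSep G))
    (hS_symm : ∀ A ∈ S, A.inv ∈ S)
    (hS_proper : ∀ A ∈ S, A.IsProper ∧ A.order < k)
    (hS_tight : ∀ A : GraphSep G, A.IsProper → A.order < k → A.IsTight → A ∈ S) :
    (∃ (T : Type) (_ : Finite T) (D : TreeDecomp G T),
      D.IsCanonical S ∧ D.EdgesIn S ∧
      D.SeparatesBlocks k ∧
      D.WellSeparatedBlocksAreParts k S ∧
      (IsReducedTask S (blockProfiles G k) → IsFeasibleTask S (blockProfiles G k) →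
        D.LeavesAreBlocks k)) ∧
    (∀ (T : Type*) [Finite T] (D : TreeDecomp G T),
      D.IsCanonical S → D.EdgesIn S → D.SeparatesBlocks k →
      ∃ (T' : Type) (_ : Finite T') (D' : TreeDecomp G T'),
        D'.Refines D ∧
        D'.IsCanonical S ∧ D'.EdgesIn S ∧
        D'.SeparatesBlocks k ∧
        D'.WellSeparatedBlocksAreParts k S ∧
        (IsReducedTask S (blockProfiles G k) → IsFeasibleTask S (blockProfiles G k) →
          D'.LeavesAreBlocks k)) := by
  obtain ⟨D, h1, h2, h3⟩ := exists_treeDecomp_separatesBlocks G k S hS_tight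
  obtain ⟨T', hT', D', -, h⟩ := D.exists_refinement hS_symm hS_proper hS_tight h1 h2 h3
  exact ⟨⟨T', hT', D', h⟩, fun T _ D => D.exists_refinement hS_symm hS_proper hS_tight⟩
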